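/- Let $R$ be a $d\times d$ expansive integer matrix (all its complex eigenvalues have modulus $>1$), let $B\subset\mathbb{Z}^d$ be a finite set with $0\in B$, put $N:=|B|$ and $\tau_b(x)=R^{-1}(x+b)$ for $b\in B$, $x\in\mathbb{R}^d$. Let $\mu=\mu(R,B)$ be the self-affine measure, i.e. the unique Borel probability measure on $\mathbb{R}^d$ with $\mu(E)=\frac1N\sum_{b\in B}\mu(\tau_b^{-1}(E))$ for all Borel sets $E$, and let $X_B=\{\sum_{k\ge1}R^{-k}b_k : b_k\in B\}$ be its attractor. Assume that there is no overlap: $\mu(\tau_b(X_B)\cap\tau_{b'}(X_B))=0$ for all $b\ne b'$ in $B$. Write $e_\lambda(x)=e^{2\pi i\lambda\cdot x}$ and $m_B(x)=\frac1N\sum_{b\in B}e^{2\pi i b\cdot x}$. For a finite set $L\subset\mathbb{Z}^d$ with $0\in L$ and complex numbers $(\alpha_l)_{l\in L}$ consider the conditions: (i) $\alpha_0=1$; (ii) the matrix $T=\frac1{\sqrt N}\left(e^{2\pi i (R^T)^{-1}l\cdot b}\,\alpha_l\right)_{l\in L,\,b\in B}$ is an isometry, i.e. $T^*T=I_N$;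 (iii) the only entire function $h$ on $\mathbb{C}^d$ with $0\le h\le1$ on $\mathbb{R}^d$, $h(0)=1$ and $$\sum_{l\in L}|\alpha_l|^2\left|m_B\big((R^T)^{-1}(t-l)\big)\right|^2h\big((R^T)^{-1}(t-l)\big)=h(t)\qquad(t\in\mathbb{R}^d)$$ is the constant function $1$. Suppose that $L$ and $(\alpha_l)_{l\in L}$ satisfy (i), (ii) and (iii). Let $L'\subset\mathbb{Z}^d$ be a finite set with $L\subseteq L'$, and let $(\alpha'_l)_{l\in L'}$ be nonzero complex numbers such that $L'$ and $(\alpha'_l)_{l\in L'}$ satisfy (i) and (ii). Let $\Omega(L')=\{\emptyset\}\cup\{l_0\dots l_k : k\ge0,\ l_i\in L',\ l_k\ne0\}$. Then the family, indexed by the words of $\Omega(L')$, $$\left\{\Big(\prod_{i=0}^k\alpha'_{l_i}\Big)\,e_{l_0+R^Tl_1+\dots+(R^T)^kl_k} : l_0\dots l_k\in\Omega(L')\right\}$$ (the empty word gives the constant function $1$) is a Parseval frame for $L^2(\mu)$: for every $f\in L^2(\mu)$, the sum over this family of $|\langle f,\cdot\rangle|^2$ equals $\|f\|^2$. -/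

import Mathlib

open MeasureTheory
open scoped Matrix ENNReal

noncomputable section

namespace FractalFrame

variable {d : ℕ}

/-- The integer vector `k`, seen as a vector of `ℝ^d`. -/
def toReal (k : Fin d → ℤ) : Fin d → ℝ := fun i => (k i : ℝ)

/-- The real vector `t`, seen as a vector of `ℂ^d`. -/
def toComplex (t : Fin d → ℝ) : Fin d → ℂ := fun i => (t i : ℂ)

/-- The integer matrix `R`, seen as a real matrix. -/
def realMat (R : Matrix (Fin d) (Fin d) ℤ) : Matrix (Fin d) (Fin d) ℝ :=
  R.map (fun n : ℤ => (n : ℝ))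

/-- An integer matrix is expansive if all its complex eigenvalues have modulus `> 1`. -/
def IsExpansive (R : Matrix (Fin d) (Fin d) ℤ) : Prop :=
  ∀ z ∈ spectrum ℂ (R.map (fun n : ℤ => (n : ℂ))), 1 < ‖z‖

/-- The affine map `τ_b(x) = R⁻¹ (x + b)`. -/
def ifsMap (R : Matrix (Fin d) (Fin d) ℤ) (b : Fin d → ℤ) (x : Fin d → ℝ) : Fin d → ℝ :=
  (realMat R)⁻¹ *ᵥ (x + toReal b)

/-- `μ` is the self-affine measure `μ(R,B)` with equal weights: the Borel probability measure with
`μ(E) = (1/N) ∑_{b ∈ B} μ(τ_b⁻¹ E)` for all Borel sets `E`, where `N = |B|`. -/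
def IsSelfAffineMeasure (R : Matrix (Fin d) (Fin d) ℤ) (B : Finset (Fin d → ℤ))
    (μ : Measure (Fin d → ℝ)) : Prop :=
  IsProbabilityMeasure μ ∧
    ∀ E : Set (Fin d → ℝ), MeasurableSet E →
      μ E = (B.card : ℝ≥0∞)⁻¹ * ∑ b ∈ B, μ (ifsMap R b ⁻¹' E)

/-- The attractor `X_B = {∑_{k ≥ 1} R^{-k} b_k : b_k ∈ B}`. -/
def attractor (R : Matrix (Fin d) (Fin d) ℤ) (B : Finset (Fin d → ℤ)) : Set (Fin d → ℝ) :=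
  {x | ∃ b : ℕ → (Fin d → ℤ), (∀ k, b k ∈ B) ∧
    HasSum (fun k : ℕ => ((realMat R)⁻¹ ^ (k + 1)) *ᵥ toReal (b k)) x}

/-- The no overlap condition: `μ(τ_b(X_B) ∩ τ_{b'}(X_B)) = 0` for distinct `b, b' ∈ B`. -/
def NoOverlap (R : Matrix (Fin d) (Fin d) ℤ) (B : Finset (Fin d → ℤ))
    (μ : Measure (Fin d → ℝ)) : Prop :=
  ∀ b ∈ B, ∀ b' ∈ B, b ≠ b' →
    μ (ifsMap R b '' attractor R B ∩ ifsMap R b' '' attractor R B) = 0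

/-- The exponential function `e_t(x) = exp(2π i t·x)`. -/
def expFun (t x : Fin d → ℝ) : ℂ :=
  Complex.exp (2 * Real.pi * Complex.I * ((t ⬝ᵥ x : ℝ) : ℂ))

/-- The matrix `T = N^{-1/2} (exp(2π i (Rᵀ)⁻¹ l · b) α_l)_{l ∈ L, b ∈ B}`. -/
def weightMatrix (R : Matrix (Fin d) (Fin d) ℤ) (B L : Finset (Fin d → ℤ))
    (α : (Fin d → ℤ) → ℂ) : Matrix L B ℂ :=
  Matrix.of fun l b => ((1 / Real.sqrt (B.card : ℝ) : ℝ) : ℂ) *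
    (expFun ((realMat R)ᵀ⁻¹ *ᵥ toReal (l : Fin d → ℤ)) (toReal (b : Fin d → ℤ)) *
      α (l : Fin d → ℤ))

/-- The matrix `T` is an isometry: `T* T = I_N`. -/
def IsometryCondition (R : Matrix (Fin d) (Fin d) ℤ) (B L : Finset (Fin d → ℤ))
    (α : (Fin d → ℤ) → ℂ) : Prop :=
  (weightMatrix R B L α)ᴴ * weightMatrix R B L α = 1

/-- `m_B(x) = (1/N) ∑_{b ∈ B} exp(2π i b·x)`. -/
def maskB (B : Finset (Fin d → ℤ)) (x : Fin d → ℝ) : ℂ :=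
  (1 / (B.card : ℂ)) * ∑ b ∈ B, expFun (toReal b) x

/-- `g_l(t) = (Rᵀ)⁻¹ (t - l)`. -/
def dualMap (R : Matrix (Fin d) (Fin d) ℤ) (l : Fin d → ℤ) (t : Fin d → ℝ) : Fin d → ℝ :=
  (realMat R)ᵀ⁻¹ *ᵥ (t - toReal l)

/-- The only entire function `h` on `ℂ^d` with `0 ≤ h ≤ 1` on `ℝ^d`, `h(0) = 1` and
`∑_{l ∈ L} |α_l|² |m_B(g_l(t))|² h(g_l(t)) = h(t)` for `t ∈ ℝ^d` is the constant `1`. -/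
def UniquenessCondition (R : Matrix (Fin d) (Fin d) ℤ) (B L : Finset (Fin d → ℤ))
    (α : (Fin d → ℤ) → ℂ) : Prop :=
  ∀ h : (Fin d → ℂ) → ℂ, Differentiable ℂ h →
    (∀ t : Fin d → ℝ, ∃ r : ℝ, 0 ≤ r ∧ r ≤ 1 ∧ h (toComplex t) = (r : ℂ)) →
    h 0 = 1 →
    (∀ t : Fin d → ℝ,
      ∑ l ∈ L, ((‖α l‖ ^ 2 * ‖maskB B (dualMap R l t)‖ ^ 2 : ℝ) : ℂ) *
        h (toComplex (dualMap R l t)) = h (toComplex t)) →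
    ∀ z, h z = 1

/-- `Ω(L)`: the finite words with letters in `L` that are empty or do not end in `0`. -/
def Words (L : Finset (Fin d → ℤ)) : Type :=
  {w : List (Fin d → ℤ) // (∀ l ∈ w, l ∈ L) ∧ w.getLast? ≠ some 0}

/-- The frequency `l_0 + Rᵀ l_1 + ⋯ + (Rᵀ)^k l_k` of the word `l_0 … l_k` (`0` if it is empty). -/
def wordFreq (R : Matrix (Fin d) (Fin d) ℤ) (w : List (Fin d → ℤ)) : Fin d → ℤ :=
  ∑ i : Fin w.length, (Rᵀ ^ (i : ℕ)) *ᵥ w.get i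

/-- The weight `∏ α_{l_i}` of the word `l_0 … l_k` (`1` if it is empty). -/
def wordWeight (α : (Fin d → ℤ) → ℂ) (w : List (Fin d → ℤ)) : ℂ :=
  (w.map α).prod

theorem memLp_const_mul_expFun (μ : Measure (Fin d → ℝ)) [IsFiniteMeasure μ] (c : ℂ)
    (t : Fin d → ℝ) : MemLp (fun x => c * expFun t x) 2 μ := by
  have hc : Continuous fun x : Fin d → ℝ => c * expFun t x := by
    unfold expFun dotProduct
    fun_prop
  refine MemLp.of_bound hc.aestronglyMeasurable ‖c‖ (Filter.Eventually.of_forall fun x => ?_)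
  have h1 : ‖expFun t x‖ = 1 := by
    have h2 : 2 * (Real.pi : ℂ) * Complex.I * ((t ⬝ᵥ x : ℝ) : ℂ) =
        ((2 * Real.pi * (t ⬝ᵥ x) : ℝ) : ℂ) * Complex.I := by
      push_cast
      ring
    unfold expFun
    rw [h2, Complex.norm_exp_ofReal_mul_I]
  rw [norm_mul, h1, mul_one]

/-- The weighted exponential function of a word, as an element of `L²(μ)`. -/
def weightedExp (R : Matrix (Fin d) (Fin d) ℤ) (L : Finset (Fin d → ℤ)) (α : (Fin d → ℤ) → ℂ)
    (μ : Measure (Fin d → ℝ)) [IsFiniteMeasure μ] (w : Words L) : Lp ℂ 2 μ :=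
  (memLp_const_mul_expFun μ (wordWeight α w.1) (toReal (wordFreq R w.1))).toLp
    (fun x => wordWeight α w.1 * expFun (toReal (wordFreq R w.1)) x)

/-- A family `(e_i)` in a Hilbert space is a Parseval frame (a frame with both bounds `1`) if
`∑_i |⟨v, e_i⟩|² = ‖v‖²` for all `v`. -/
def IsParsevalFrame {ι H : Type*} [NormedAddCommGroup H] [InnerProductSpace ℂ H]
    (e : ι → H) : Prop :=
  ∀ v : H, HasSum (fun i => ‖inner ℂ v (e i)‖ ^ 2) (‖v‖ ^ 2)

end FractalFrame

end

open FractalFrame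

noncomputable section

namespace FractalFrame

open Filter Topology
open scoped ComplexConjugate BoundedContinuousFunction InnerProductSpace

/-! Write `ψ_w` for the weighted exponential of the word `w` and `g_l` for `dualMap R l`. The
operators `transfer` strip a first letter: `⟨transfer_l f, ψ_w⟩ = ⟨f, ψ_{lw}⟩`
(`wordCoeff_transfer`), and by (ii) their energies add up to `‖f‖²`
(`sum_integral_norm_sq_transfer`). Induction on the word length then shows that the family is Bessel
with bound `1`. Because the exponentials span a dense subspace, it is Parseval as soon as `h(t) =
∑_w |⟨e_t, ψ_w⟩|²` (`frameFun`) is identically `1`.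

Since `transfer` sends `e_t` to a multiple of `e_{g_l(t)}`, `h` solves the equation in (iii), and it
extends to an entire function because `μ` has bounded support. So (iii) gives `h = 1` for `L`. Every
word over `L` is a word over `L'`, and the weights over `L'` are nonzero, so `h > 0` for `L'`
(`frameFun_pos_of_subset`).

Positivity suffices, by a minimum principle (`frameFun_eq_one_of_pos`): the coefficients in the
equation sum to `1`, so a minimum of `h` over a compact invariant set is passed on by each `g_l` of
nonzero coefficient. A word with `⟨e_t, ψ_w⟩ ≠ 0` at the minimum point, followed by iterates of
`g_0`, carries the minimum to `0`, where `h = 1`. -/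

/-! ### Powers of the inverse matrix and contracted gauges. -/

theorem tendsto_pow_zero_of_spectralRadius_lt_one {A : Type*} [NormedRing A] [NormedAlgebra ℂ A]
    [CompleteSpace A] (a : A) (h : spectralRadius ℂ a < 1) :
    Tendsto (fun n : ℕ => a ^ n) atTop (𝓝 0) := by
  obtain ⟨r, hr, hr1⟩ := exists_between h
  lift r to NNReal using ne_top_of_lt hr1
  have hr1' : r < 1 := by exact_mod_cast hr1
  -- Gelfand's formula: eventually `‖a ^ n‖ ≤ r ^ n` with `r < 1`.
  have h1 := (spectrum.pow_nnnorm_pow_one_div_tendsto_nhds_spectralRadius a).eventually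
    (gt_mem_nhds hr)
  have h2 : ∀ᶠ n : ℕ in atTop, ‖a ^ n‖ ≤ (r : ℝ) ^ n := by
    filter_upwards [h1, eventually_gt_atTop 0] with n hn hn0
    have h3 : ((‖a ^ n‖₊ : ℝ≥0∞) ^ (1 / n : ℝ)) ^ (n : ℝ) ≤ (r : ℝ≥0∞) ^ (n : ℝ) :=
      ENNReal.rpow_le_rpow hn.le (by positivity)
    rw [← ENNReal.rpow_mul, one_div_mul_cancel (by positivity), ENNReal.rpow_one,
      ENNReal.rpow_natCast] at h3
    exact_mod_cast h3
  rw [tendsto_zero_iff_norm_tendsto_zero]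
  exact squeeze_zero' (Eventually.of_forall fun n => norm_nonneg _) h2
    (tendsto_pow_atTop_nhds_zero_of_lt_one r.2 (by exact_mod_cast hr1'))

section LinftyNorm

attribute [local instance] Matrix.linftyOpNormedRing Matrix.linftyOpNormedAlgebra

theorem tendsto_pow_zero_of_forall_spectrum {d : ℕ} (A : Matrix (Fin d) (Fin d) ℂ)
    (h : ∀ z ∈ spectrum ℂ A, ‖z‖ < 1) : Tendsto (fun n : ℕ => A ^ n) atTop (𝓝 0) := by
  rcases isEmpty_or_nonempty (Fin d) with hd | hd
  · have : (fun n : ℕ => A ^ n) = fun _ => 0 := by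
      funext n
      exact Subsingleton.elim _ _
    rw [this]
    exact tendsto_const_nhds
  · apply tendsto_pow_zero_of_spectralRadius_lt_one
    have := spectrum.spectralRadius_lt_of_forall_lt A (r := 1) (fun z hz => by
      rw [← NNReal.coe_lt_coe]
      simpa using h z hz)
    simpa using this

/-- A gauge that is contracted by a matrix whose powers tend to zero. -/
theorem exists_contracting_gauge {d : ℕ} (M : Matrix (Fin d) (Fin d) ℝ)
    (hM : Tendsto (fun n : ℕ => M ^ n) atTop (𝓝 0)) :
    ∃ p : (Fin d → ℝ) → ℝ, Continuous p ∧ (∀ x, ‖x‖ ≤ p x) ∧ (∀ x y, p (x + y) ≤ p x + p y) ∧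
      ∃ θ : ℝ, 0 < θ ∧ θ < 1 ∧ ∀ x, p (M *ᵥ x) ≤ θ * p x := by
  have h0 : Tendsto (fun n : ℕ => ‖M ^ n‖) atTop (𝓝 0) := tendsto_zero_iff_norm_tendsto_zero.1 hM
  obtain ⟨n, hn, hn0⟩ := ((h0.eventually (gt_mem_nhds (show (0 : ℝ) < 1 / 2 by norm_num))).and
    (eventually_gt_atTop 0)).exists
  -- The summand `1` gives `C ≥ 1`, hence `1 - 1 / (2 * C) > 0` below.
  set C : ℝ := ∑ k ∈ Finset.range n, ‖M ^ k‖ + 1 with hC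
  have hC0 : 1 ≤ C := by
    have : 0 ≤ ∑ k ∈ Finset.range n, ‖M ^ k‖ := Finset.sum_nonneg fun _ _ => norm_nonneg _
    linarith
  set p : (Fin d → ℝ) → ℝ := fun x => ∑ k ∈ Finset.range n, ‖(M ^ k) *ᵥ x‖ with hp
  have hpn : ∀ x, ‖x‖ ≤ p x := by
    intro x
    have := Finset.single_le_sum (f := fun k => ‖(M ^ k) *ᵥ x‖) (fun _ _ => norm_nonneg _)
      (Finset.mem_range.2 hn0)
    simpa using this
  have hpC : ∀ x, p x ≤ C * ‖x‖ := by
    intro x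
    rw [hC, add_mul, Finset.sum_mul]
    have : p x ≤ ∑ k ∈ Finset.range n, ‖M ^ k‖ * ‖x‖ :=
      Finset.sum_le_sum fun k _ => Matrix.linfty_opNorm_mulVec _ _
    have h2 := norm_nonneg x
    linarith
  refine ⟨p, ?_, hpn, ?_, 1 - 1 / (2 * C), ?_, ?_, ?_⟩
  · refine continuous_finsetSum _ fun k _ => Continuous.norm ?_
    exact Continuous.matrix_mulVec continuous_const continuous_id
  · intro x y
    rw [hp, ← Finset.sum_add_distrib]
    refine Finset.sum_le_sum fun k _ => ?_
    rw [Matrix.mulVec_add]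
    exact norm_add_le _ _
  · have : 1 / (2 * C) ≤ 1 / 2 := by
      apply one_div_le_one_div_of_le <;> linarith
    linarith
  · have : 0 < 1 / (2 * C) := by positivity
    linarith
  · intro x
    -- Telescoping: `p` loses `‖x‖` and gains at most `‖x‖ / 2`, and `‖x‖ / 2` is at least `p x / (2
    -- * C)`.
    have h1 : p (M *ᵥ x) + ‖x‖ = p x + ‖(M ^ n) *ᵥ x‖ := by
      have h2 : p (M *ᵥ x) = ∑ k ∈ Finset.range n, ‖(M ^ (k + 1)) *ᵥ x‖ := by
        refine Finset.sum_congr rfl fun k _ => ?_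
        rw [Matrix.mulVec_mulVec, pow_succ]
      have h3 := Finset.sum_range_succ (fun k => ‖(M ^ k) *ᵥ x‖) n
      have h4 := Finset.sum_range_succ' (fun k => ‖(M ^ k) *ᵥ x‖) n
      simp only [pow_zero, Matrix.one_mulVec] at h4
      rw [h2, ← h4, h3]
    have h5 : ‖(M ^ n) *ᵥ x‖ ≤ 1 / 2 * ‖x‖ :=
      (Matrix.linfty_opNorm_mulVec _ _).trans (by gcongr)
    have h6 : 1 / (2 * C) * p x ≤ 1 / 2 * ‖x‖ := by
      calc 1 / (2 * C) * p x ≤ 1 / (2 * C) * (C * ‖x‖) := by gcongr; exact hpC x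
        _ = 1 / 2 * ‖x‖ := by field_simp
    linarith

end LinftyNorm

theorem isUnit_of_isExpansive {d : ℕ} {R : Matrix (Fin d) (Fin d) ℤ} (hR : IsExpansive R) :
    IsUnit (R.map (fun n : ℤ => (n : ℂ))) := by
  by_contra h
  have := hR 0 (spectrum.zero_mem_iff ℂ |>.2 h)
  simp at this
  linarith

theorem isUnit_realMat_det {d : ℕ} {R : Matrix (Fin d) (Fin d) ℤ} (hR : IsExpansive R) :
    IsUnit (realMat R).det := by
  have h := (Matrix.isUnit_iff_isUnit_det _).1 (isUnit_of_isExpansive hR)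
  have h1 : (R.map (fun n : ℤ => (n : ℂ))).det = ((R.det : ℤ) : ℂ) :=
    (RingHom.map_det (Int.castRingHom ℂ) R).symm
  have h2 : (realMat R).det = ((R.det : ℤ) : ℝ) := (RingHom.map_det (Int.castRingHom ℝ) R).symm
  rw [h1, isUnit_iff_ne_zero] at h
  rw [h2, isUnit_iff_ne_zero]
  exact_mod_cast h

/-- The eigenvalues of the inverse are the inverses of eigenvalues of modulus `> 1`. The spectral
argument is complex; the real statement follows by taking real parts of entries. -/
theorem tendsto_inv_realMat_pow {d : ℕ} {R : Matrix (Fin d) (Fin d) ℤ} (hR : IsExpansive R) :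
    Tendsto (fun n : ℕ => ((realMat R)⁻¹) ^ n) atTop (𝓝 0) := by
  set A := R.map (fun n : ℤ => (n : ℂ)) with hA
  have hAinv : A⁻¹ = ((realMat R)⁻¹).map Complex.ofReal := by
    apply Matrix.inv_eq_right_inv
    have h1 : A = (realMat R).map Complex.ofReal := by
      ext i j
      simp [hA, realMat]
    have h2 := congrArg (Complex.ofRealHom.mapMatrix) (Matrix.mul_nonsing_inv _ (isUnit_realMat_det hR))
    rw [map_mul, map_one] at h2
    rw [h1]
    exact h2
  have hAt : Tendsto (fun n : ℕ => A⁻¹ ^ n) atTop (𝓝 0) := by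
    apply tendsto_pow_zero_of_forall_spectrum
    intro z hz
    obtain ⟨u, hu⟩ := isUnit_of_isExpansive hR
    have h3 : A⁻¹ = ((u⁻¹ : (Matrix (Fin d) (Fin d) ℂ)ˣ) : Matrix (Fin d) (Fin d) ℂ) := by
      rw [hA, ← hu, Matrix.coe_units_inv]
    rw [h3, ← spectrum.map_inv, Set.mem_inv, hu] at hz
    have h4 := hR _ hz
    rw [norm_inv] at h4
    by_contra! h5
    exact absurd (inv_le_one_of_one_le₀ h5) (not_le.2 h4)
  have hpow : ∀ n : ℕ, A⁻¹ ^ n = (((realMat R)⁻¹) ^ n).map Complex.ofReal := by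
    intro n
    rw [hAinv]
    exact (map_pow (Complex.ofRealHom.mapMatrix) _ n).symm
  refine tendsto_pi_nhds.2 fun i => tendsto_pi_nhds.2 fun j => ?_
  have h6 := (tendsto_pi_nhds.1 (tendsto_pi_nhds.1 hAt i) j)
  have h7 := (Complex.continuous_re.tendsto _).comp h6
  refine h7.congr fun n => ?_
  simp [hpow]

theorem tendsto_inv_realMat_transpose_pow {d : ℕ} {R : Matrix (Fin d) (Fin d) ℤ}
    (hR : IsExpansive R) : Tendsto (fun n : ℕ => ((realMat R)ᵀ⁻¹) ^ n) atTop (𝓝 0) := by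
  have h : Tendsto (fun n : ℕ => (((realMat R)⁻¹) ^ n)ᵀ) atTop (𝓝 0ᵀ) :=
    (Continuous.matrix_transpose continuous_id).tendsto 0 |>.comp (tendsto_inv_realMat_pow hR)
  simpa [Matrix.transpose_pow, Matrix.transpose_nonsing_inv] using h

/-- A gauge whose sublevel sets are shrunk by the affine maps `x ↦ M (x + c)`, `c ∈ C`. -/
theorem exists_affine_contracting_gauge {d : ℕ} (M : Matrix (Fin d) (Fin d) ℝ)
    (hM : Tendsto (fun n : ℕ => M ^ n) atTop (𝓝 0)) (C : Finset (Fin d → ℝ)) :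
    ∃ p : (Fin d → ℝ) → ℝ, Continuous p ∧ (∀ x, ‖x‖ ≤ p x) ∧ ∃ r θ : ℝ, 0 < θ ∧ θ < 1 ∧
      ∀ c ∈ C, ∀ x u, p x ≤ r + u → p (M *ᵥ (x + c)) ≤ r + θ * u := by
  obtain ⟨p, hpc, hpn, hpa, θ, hθ0, hθ1, hpθ⟩ := exists_contracting_gauge M hM
  have hp0 : ∀ x, 0 ≤ p x := fun x => (norm_nonneg x).trans (hpn x)
  refine ⟨p, hpc, hpn, θ * (∑ c ∈ C, p c) / (1 - θ), θ, hθ0, hθ1, fun c hc x u hx => ?_⟩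
  set β := ∑ c ∈ C, p c
  -- `r` is the fixed point of `s ↦ θ * (s + β)`, so only the excess `u` over `r` is scaled by `θ`.
  set r := θ * β / (1 - θ) with hr
  have h1 : p c ≤ β := Finset.single_le_sum (fun c _ => hp0 c) hc
  have h2 : r * (1 - θ) = θ * β := by
    rw [hr, div_mul_cancel₀]
    linarith
  calc p (M *ᵥ (x + c)) ≤ θ * p (x + c) := hpθ _
    _ ≤ θ * ((r + u) + β) := by
        gcongr
        linarith [hpa x c]
    _ = r + θ * u := by linarith

/-! ### The self-affine measure: invariance of integrals and bounded support. -/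

theorem continuous_ifsMap {d : ℕ} (R : Matrix (Fin d) (Fin d) ℤ) (b : Fin d → ℤ) :
    Continuous (ifsMap R b) :=
  Continuous.matrix_mulVec continuous_const (continuous_id.add continuous_const)

theorem IsSelfAffineMeasure.eq_smul_sum_map {d : ℕ} {R : Matrix (Fin d) (Fin d) ℤ}
    {B : Finset (Fin d → ℤ)} {μ : Measure (Fin d → ℝ)} (hμ : IsSelfAffineMeasure R B μ) :
    μ = (B.card : ℝ≥0∞)⁻¹ • ∑ b ∈ B, μ.map (ifsMap R b) := by
  ext E hE
  rw [Measure.smul_apply, Measure.finsetSum_apply, hμ.2 E hE, smul_eq_mul]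
  congr 1
  refine Finset.sum_congr rfl fun b _ => ?_
  rw [Measure.map_apply (continuous_ifsMap R b).measurable hE]

theorem IsSelfAffineMeasure.integral_eq {d : ℕ} {R : Matrix (Fin d) (Fin d) ℤ}
    {B : Finset (Fin d → ℤ)} {μ : Measure (Fin d → ℝ)} [IsProbabilityMeasure μ]
    (hμ : IsSelfAffineMeasure R B μ)
    {E : Type*} [NormedAddCommGroup E] [NormedSpace ℝ E] [SecondCountableTopologyEither (Fin d → ℝ) E]
    {f : (Fin d → ℝ) → E} (hf : Continuous f) {C : ℝ} (hC : ∀ x, ‖f x‖ ≤ C) :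
    ∫ x, f x ∂μ = (B.card : ℝ)⁻¹ • ∑ b ∈ B, ∫ x, f (ifsMap R b x) ∂μ := by
  conv_lhs => rw [hμ.eq_smul_sum_map]
  have hint : ∀ b ∈ B, Integrable f (μ.map (ifsMap R b)) := by
    intro b _
    have := Measure.isProbabilityMeasure_map (μ := μ) (continuous_ifsMap R b).aemeasurable
    exact Integrable.of_bound hf.aestronglyMeasurable C (Eventually.of_forall hC)
  rw [integral_smul_measure, integral_finsetSum_measure hint]
  congr 1
  · simp
  · refine Finset.sum_congr rfl fun b _ => ?_
    exact integral_map (continuous_ifsMap R b).aemeasurable hf.aestronglyMeasurable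

/-- A point sent by some `τ_b` to gauge above `r + u` has gauge above `r + u / θ`. By invariance the
mass above `r + 1` is thus at most the mass above `r + θ⁻¹ ^ n` for all `n`, which tends to `0`. -/
theorem IsSelfAffineMeasure.exists_ae_norm_le {d : ℕ} {R : Matrix (Fin d) (Fin d) ℤ}
    (hR : IsExpansive R) {B : Finset (Fin d → ℤ)} (hB : B.Nonempty)
    {μ : Measure (Fin d → ℝ)} [IsProbabilityMeasure μ]
    (hμ : IsSelfAffineMeasure R B μ) : ∃ r : ℝ, ∀ᵐ x ∂μ, ‖x‖ ≤ r := by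
  obtain ⟨p, hpc, hpn, r, θ, hθ0, hθ1, h⟩ := exists_affine_contracting_gauge _
    (tendsto_inv_realMat_pow hR) (B.image toReal)
  have hcard : (B.card : ℝ≥0∞) ≠ 0 := by
    exact_mod_cast hB.card_pos.ne'
  have hmeas : ∀ u : ℝ, MeasurableSet {x | r + u < p x} := fun u =>
    (isOpen_lt continuous_const hpc).measurableSet
  have hstep : ∀ u : ℝ, μ {x | r + u < p x} ≤ μ {x | r + θ⁻¹ * u < p x} := by
    intro u
    rw [hμ.2 _ (hmeas u)]
    calc (B.card : ℝ≥0∞)⁻¹ * ∑ b ∈ B, μ (ifsMap R b ⁻¹' {x | r + u < p x})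
        ≤ (B.card : ℝ≥0∞)⁻¹ * ∑ b ∈ B, μ {x | r + θ⁻¹ * u < p x} := by
          gcongr with b hb
          intro x hx
          by_contra hx'
          have h1 := h (toReal b) (Finset.mem_image_of_mem _ hb) x (θ⁻¹ * u) (not_lt.1 hx')
          rw [mul_inv_cancel_left₀ hθ0.ne'] at h1
          exact absurd hx (not_lt.2 h1)
      _ = μ {x | r + θ⁻¹ * u < p x} := by
          rw [Finset.sum_const, nsmul_eq_mul, ← mul_assoc,
            ENNReal.inv_mul_cancel hcard (ENNReal.natCast_ne_top _), one_mul]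
  have hiter : ∀ n : ℕ, μ {x | r + 1 < p x} ≤ μ {x | r + θ⁻¹ ^ n < p x} := by
    intro n
    induction n with
    | zero => simp
    | succ n ih =>
      refine ih.trans ((hstep _).trans_eq ?_)
      rw [pow_succ']
  have hθ1' : 1 < θ⁻¹ := (one_lt_inv₀ hθ0).2 hθ1
  have hlim := tendsto_measure_iInter_atTop (μ := μ) (s := fun n : ℕ => {x | r + θ⁻¹ ^ n < p x})
    (fun n => (hmeas _).nullMeasurableSet)
    (fun m n hmn x hx => lt_of_le_of_lt
      ((add_le_add_iff_left r).2 (pow_le_pow_right₀ hθ1'.le hmn)) hx)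
    ⟨0, measure_ne_top _ _⟩
  have hempty : ⋂ n : ℕ, {x | r + θ⁻¹ ^ n < p x} = ∅ := by
    refine Set.eq_empty_iff_forall_notMem.2 fun x hx => ?_
    obtain ⟨n, hn⟩ := pow_unbounded_of_one_lt (p x - r) hθ1'
    have := Set.mem_iInter.1 hx n
    simp only [Set.mem_ofPred_eq] at this
    linarith
  rw [hempty, measure_empty] at hlim
  have h0 : μ {x | r + 1 < p x} = 0 := le_antisymm (ge_of_tendsto' hlim hiter) zero_le
  refine ⟨r + 1, ?_⟩
  rw [ae_iff]
  refine measure_mono_null (fun x hx => ?_) h0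
  exact lt_of_lt_of_le (not_le.1 hx) (hpn x)

/-! ### Exponentials, transfer operators and word coefficients. -/

variable {d : ℕ}

theorem expFun_eq (t x : Fin d → ℝ) :
    expFun t x = Complex.exp ((2 * Real.pi * (t ⬝ᵥ x) : ℝ) * Complex.I) := by
  unfold expFun
  congr 1
  push_cast
  ring

theorem norm_expFun (t x : Fin d → ℝ) : ‖expFun t x‖ = 1 := by
  rw [expFun_eq, Complex.norm_exp_ofReal_mul_I]

theorem expFun_add_left (s t x : Fin d → ℝ) : expFun (s + t) x = expFun s x * expFun t x := by
  unfold expFun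
  rw [← Complex.exp_add, add_dotProduct]
  push_cast
  ring_nf

theorem expFun_add_right (t x y : Fin d → ℝ) : expFun t (x + y) = expFun t x * expFun t y := by
  unfold expFun
  rw [← Complex.exp_add, dotProduct_add]
  push_cast
  ring_nf

theorem expFun_comm (t x : Fin d → ℝ) : expFun t x = expFun x t := by
  unfold expFun
  rw [dotProduct_comm]

@[simp]
theorem expFun_zero_left (x : Fin d → ℝ) : expFun 0 x = 1 := by
  simp [expFun]

theorem conj_expFun (t x : Fin d → ℝ) : conj (expFun t x) = expFun (-t) x := by
  rw [expFun_eq, expFun_eq, ← Complex.exp_conj, neg_dotProduct]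
  simp [map_ofNat]

theorem continuous_expFun (t : Fin d → ℝ) : Continuous (expFun t) := by
  unfold expFun dotProduct
  fun_prop

theorem expFun_mulVec (M : Matrix (Fin d) (Fin d) ℝ) (t x : Fin d → ℝ) :
    expFun t (M *ᵥ x) = expFun (Mᵀ *ᵥ t) x := by
  unfold expFun
  rw [Matrix.dotProduct_mulVec, Matrix.mulVec_transpose]

theorem expFun_toReal (k b : Fin d → ℤ) : expFun (toReal k) (toReal b) = 1 := by
  have h : toReal k ⬝ᵥ toReal b = ((k ⬝ᵥ b : ℤ) : ℝ) := by
    simp [toReal, dotProduct]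
  unfold expFun
  rw [h, Complex.exp_eq_one_iff]
  exact ⟨k ⬝ᵥ b, by push_cast; ring⟩

theorem toReal_add (k l : Fin d → ℤ) : toReal (k + l) = toReal k + toReal l := by
  ext i
  simp [toReal]

theorem toReal_mulVec (R : Matrix (Fin d) (Fin d) ℤ) (k : Fin d → ℤ) :
    toReal (Rᵀ *ᵥ k) = (realMat R)ᵀ *ᵥ toReal k := by
  ext i
  simp [toReal, Matrix.mulVec, dotProduct, realMat]

/-- The exponential `e_t` as a bounded continuous function. -/
def expBdd (t : Fin d → ℝ) : (Fin d → ℝ) →ᵇ ℂ :=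
  BoundedContinuousFunction.ofNormedAddCommGroup (expFun t) (continuous_expFun t) 1
    fun x => (norm_expFun t x).le

@[simp]
theorem expBdd_apply (t x : Fin d → ℝ) : expBdd t x = expFun t x := rfl

/-- The transfer operator `f ↦ conj(α_l) N⁻¹ ∑_b conj(e_l ∘ τ_b) (f ∘ τ_b)`. -/
def transfer (R : Matrix (Fin d) (Fin d) ℤ) (B : Finset (Fin d → ℤ)) (α : (Fin d → ℤ) → ℂ)
    (l : Fin d → ℤ) (f : (Fin d → ℝ) →ᵇ ℂ) : (Fin d → ℝ) →ᵇ ℂ :=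
  (conj (α l) * (B.card : ℂ)⁻¹) •
    ∑ b ∈ B, (expBdd (-toReal l) * f).compContinuous ⟨ifsMap R b, continuous_ifsMap R b⟩

theorem transfer_apply (R : Matrix (Fin d) (Fin d) ℤ) (B : Finset (Fin d → ℤ))
    (α : (Fin d → ℤ) → ℂ) (l : Fin d → ℤ) (f : (Fin d → ℝ) →ᵇ ℂ) (x : Fin d → ℝ) :
    transfer R B α l f x = (conj (α l) * (B.card : ℂ)⁻¹) *
      ∑ b ∈ B, expFun (-toReal l) (ifsMap R b x) * f (ifsMap R b x) := by
  simp [transfer, BoundedContinuousFunction.coe_sum]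

theorem expFun_ifsMap (R : Matrix (Fin d) (Fin d) ℤ) (b : Fin d → ℤ) (t x : Fin d → ℝ) :
    expFun t (ifsMap R b x) =
      expFun ((realMat R)ᵀ⁻¹ *ᵥ t) x * expFun ((realMat R)ᵀ⁻¹ *ᵥ t) (toReal b) := by
  rw [ifsMap, expFun_mulVec, Matrix.transpose_nonsing_inv, expFun_add_right]

theorem star_dotProduct_self_eq {ι : Type*} [Fintype ι] (u : ι → ℂ) :
    star u ⬝ᵥ u = ((∑ i, ‖u i‖ ^ 2 : ℝ) : ℂ) := by
  simp only [dotProduct, Pi.star_apply, RCLike.star_def, RCLike.conj_mul]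
  push_cast
  rfl

theorem sum_norm_sq_mulVec_of_isometry {m n : Type*} [Fintype m] [Fintype n] [DecidableEq n]
    {T : Matrix m n ℂ} (hT : Tᴴ * T = 1) (v : n → ℂ) :
    ∑ i, ‖(T *ᵥ v) i‖ ^ 2 = ∑ j, ‖v j‖ ^ 2 := by
  have h : star (T *ᵥ v) ⬝ᵥ (T *ᵥ v) = star v ⬝ᵥ v := by
    rw [Matrix.star_mulVec, Matrix.dotProduct_mulVec, Matrix.vecMul_vecMul, hT, Matrix.vecMul_one]
  rw [star_dotProduct_self_eq, star_dotProduct_self_eq] at h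
  exact_mod_cast h

/-- At a fixed `x`, the conjugates of the transferred values are, up to unimodular factors and
`N^{-1/2}`, the entries of `T v` with `v_b = conj (f (τ_b x))`. This is where (ii) enters. -/
theorem sum_norm_sq_transfer_apply {R : Matrix (Fin d) (Fin d) ℤ} {B L : Finset (Fin d → ℤ)}
    {α : (Fin d → ℤ) → ℂ} (hiso : IsometryCondition R B L α)
    (f : (Fin d → ℝ) →ᵇ ℂ) (x : Fin d → ℝ) :
    ∑ l ∈ L, ‖transfer R B α l f x‖ ^ 2 =
      (B.card : ℝ)⁻¹ * ∑ b ∈ B, ‖f (ifsMap R b x)‖ ^ 2 := by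
  set v : B → ℂ := fun b => conj (f (ifsMap R b x)) with hv
  have h1 := sum_norm_sq_mulVec_of_isometry hiso v
  have h2 : ∀ l : L, ‖transfer R B α l f x‖ ^ 2 =
      (B.card : ℝ)⁻¹ * ‖(weightMatrix R B L α *ᵥ v) l‖ ^ 2 := by
    intro l
    have h3 : conj (transfer R B α l f x) =
        (((1 / Real.sqrt (B.card : ℝ) : ℝ) : ℂ) *
          expFun ((realMat R)ᵀ⁻¹ *ᵥ toReal (l : Fin d → ℤ)) x) *
          (weightMatrix R B L α *ᵥ v) l := by
      have hN : (B.card : ℂ)⁻¹ = ((1 / Real.sqrt (B.card : ℝ) : ℝ) : ℂ) *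
          ((1 / Real.sqrt (B.card : ℝ) : ℝ) : ℂ) := by
        rw [← Complex.ofReal_mul, div_mul_div_comm, Real.mul_self_sqrt (by positivity)]
        simp
      rw [transfer_apply, map_mul, map_mul, Complex.conj_conj, map_inv₀, map_sum, Complex.conj_natCast,
        hN, Matrix.mulVec, dotProduct, Finset.mul_sum, Finset.mul_sum, ← Finset.sum_coe_sort B]
      refine Finset.sum_congr rfl fun b _ => ?_
      rw [map_mul, conj_expFun, neg_neg, expFun_ifsMap, weightMatrix, Matrix.of_apply, hv]
      ring
    rw [← Complex.norm_conj, h3, norm_mul, norm_mul, norm_expFun, mul_pow, Complex.norm_real,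
      Real.norm_of_nonneg (by positivity), mul_one, div_pow, Real.sq_sqrt (by positivity), one_pow,
      one_div]
  rw [← Finset.sum_coe_sort L, Finset.sum_congr rfl fun l _ => h2 l, ← Finset.mul_sum, h1,
    ← Finset.sum_coe_sort B]
  simp [hv]

theorem continuous_norm_sq_bdd (f : (Fin d → ℝ) →ᵇ ℂ) : Continuous fun x => ‖f x‖ ^ 2 :=
  f.continuous.norm.pow 2

theorem norm_norm_sq_le (f : (Fin d → ℝ) →ᵇ ℂ) (x : Fin d → ℝ) : ‖‖f x‖ ^ 2‖ ≤ ‖f‖ ^ 2 := by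
  rw [norm_pow, norm_norm]
  exact pow_le_pow_left₀ (norm_nonneg _) (f.norm_coe_le_norm x) 2

theorem integrable_norm_sq (μ : Measure (Fin d → ℝ)) [IsProbabilityMeasure μ]
    (f : (Fin d → ℝ) →ᵇ ℂ) : Integrable (fun x => ‖f x‖ ^ 2) μ :=
  Integrable.of_bound (continuous_norm_sq_bdd f).aestronglyMeasurable (‖f‖ ^ 2)
    (Eventually.of_forall fun x => norm_norm_sq_le f x)

theorem sum_integral_norm_sq_transfer {R : Matrix (Fin d) (Fin d) ℤ} {B L : Finset (Fin d → ℤ)}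
    {α : (Fin d → ℤ) → ℂ} (hiso : IsometryCondition R B L α)
    {μ : Measure (Fin d → ℝ)} [IsProbabilityMeasure μ] (hμ : IsSelfAffineMeasure R B μ)
    (f : (Fin d → ℝ) →ᵇ ℂ) :
    ∑ l ∈ L, ∫ x, ‖transfer R B α l f x‖ ^ 2 ∂μ = ∫ x, ‖f x‖ ^ 2 ∂μ := by
  rw [hμ.integral_eq (continuous_norm_sq_bdd f) (norm_norm_sq_le f),
    ← integral_finsetSum _ fun l _ => integrable_norm_sq μ _]
  simp_rw [sum_norm_sq_transfer_apply hiso]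
  rw [integral_const_mul, integral_finsetSum, smul_eq_mul]
  intro b _
  exact integrable_norm_sq μ (f.compContinuous ⟨ifsMap R b, continuous_ifsMap R b⟩)

/-- The inner product of `f` with the weighted exponential of the word `w`. -/
def wordCoeff (R : Matrix (Fin d) (Fin d) ℤ) (α : (Fin d → ℤ) → ℂ) (μ : Measure (Fin d → ℝ))
    (f : (Fin d → ℝ) →ᵇ ℂ) (w : List (Fin d → ℤ)) : ℂ :=
  ∫ x, conj (f x) * (wordWeight α w * expFun (toReal (wordFreq R w)) x) ∂μ

theorem wordFreq_nil (R : Matrix (Fin d) (Fin d) ℤ) : wordFreq R [] = 0 := by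
  simp [wordFreq]

theorem wordFreq_cons (R : Matrix (Fin d) (Fin d) ℤ) (l : Fin d → ℤ) (w : List (Fin d → ℤ)) :
    wordFreq R (l :: w) = l + Rᵀ *ᵥ wordFreq R w := by
  unfold wordFreq
  have := Fin.sum_univ_succ (n := w.length) fun i : Fin (w.length + 1) =>
    (Rᵀ ^ (i : ℕ)) *ᵥ (l :: w).get i
  refine this.trans ?_
  simp only [Fin.val_zero, pow_zero, Matrix.one_mulVec, Fin.val_succ]
  rw [Matrix.mulVec_sum]
  congr 1
  refine Finset.sum_congr rfl fun i _ => ?_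
  rw [Matrix.mulVec_mulVec, pow_succ']
  rfl

theorem toReal_zero : toReal (0 : Fin d → ℤ) = 0 := by
  ext i
  simp [toReal]

theorem wordCoeff_nil (R : Matrix (Fin d) (Fin d) ℤ) (α : (Fin d → ℤ) → ℂ)
    (μ : Measure (Fin d → ℝ)) (f : (Fin d → ℝ) →ᵇ ℂ) :
    wordCoeff R α μ f [] = ∫ x, conj (f x) ∂μ := by
  simp [wordCoeff, wordFreq_nil, wordWeight, toReal_zero]

/-- The shift by `b` is invisible because `e_k(b) = 1` for integer vectors. -/
theorem expFun_transpose_mulVec_ifsMap {R : Matrix (Fin d) (Fin d) ℤ} (hR : IsExpansive R)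
    (k b : Fin d → ℤ) (x : Fin d → ℝ) :
    expFun (toReal (Rᵀ *ᵥ k)) (ifsMap R b x) = expFun (toReal k) x := by
  have hu : IsUnit ((realMat R)ᵀ).det := by
    rw [Matrix.det_transpose]
    exact isUnit_realMat_det hR
  rw [expFun_ifsMap, toReal_mulVec, Matrix.mulVec_mulVec, Matrix.nonsing_inv_mul _ hu,
    Matrix.one_mulVec, expFun_toReal, mul_one]

/-- The frequency of `l :: w` is `l` plus `Rᵀ` times that of `w`, so `ψ_{lw} ∘ τ_b = α_l (e_l ∘ τ_b)
ψ_w` for every `b`; invariance of `μ` averages over `b`. -/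
theorem wordCoeff_transfer {R : Matrix (Fin d) (Fin d) ℤ} (hR : IsExpansive R)
    {B : Finset (Fin d → ℤ)} (α : (Fin d → ℤ) → ℂ)
    {μ : Measure (Fin d → ℝ)} [IsProbabilityMeasure μ] (hμ : IsSelfAffineMeasure R B μ)
    (f : (Fin d → ℝ) →ᵇ ℂ) (l : Fin d → ℤ) (w : List (Fin d → ℤ)) :
    wordCoeff R α μ (transfer R B α l f) w = wordCoeff R α μ f (l :: w) := by
  unfold wordCoeff
  have hcont : Continuous fun x => conj (f x) *
      (wordWeight α (l :: w) * expFun (toReal (wordFreq R (l :: w))) x) :=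
    (Complex.continuous_conj.comp f.continuous).mul
      (continuous_const.mul (continuous_expFun _))
  rw [hμ.integral_eq hcont (C := ‖f‖ * ‖wordWeight α (l :: w)‖)]
  · rw [← integral_finsetSum, ← integral_smul]
    · congr 1
      funext x
      rw [transfer_apply, map_mul, map_mul, Complex.conj_conj, map_inv₀, map_sum,
        Complex.conj_natCast, Complex.real_smul, Finset.mul_sum, Finset.mul_sum, Finset.sum_mul]
      refine Finset.sum_congr rfl fun b _ => ?_
      rw [map_mul, conj_expFun, neg_neg, wordFreq_cons, toReal_add, expFun_add_left,
        expFun_transpose_mulVec_ifsMap hR, wordWeight, wordWeight, List.map_cons, List.prod_cons]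
      push_cast
      ring
    · intro b _
      refine Integrable.of_bound
        (hcont.comp (continuous_ifsMap R b)).aestronglyMeasurable (‖f‖ * ‖wordWeight α (l :: w)‖)
        (Eventually.of_forall fun x => ?_)
      rw [norm_mul, norm_mul, norm_expFun, mul_one, Complex.norm_conj]
      gcongr
      exact f.norm_coe_le_norm _
  · intro x
    rw [norm_mul, norm_mul, norm_expFun, mul_one, Complex.norm_conj]
    gcongr
    exact f.norm_coe_le_norm _

/-- Exponentials are mapped to multiples of exponentials; this turns identities for `transfer` into
the functional equation of (iii). -/
theorem transfer_expBdd (R : Matrix (Fin d) (Fin d) ℤ) (B : Finset (Fin d → ℤ))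
    (α : (Fin d → ℤ) → ℂ) (l : Fin d → ℤ) (t : Fin d → ℝ) :
    transfer R B α l (expBdd t) =
      (conj (α l) * maskB B (dualMap R l t)) • expBdd (dualMap R l t) := by
  ext x
  rw [transfer_apply, BoundedContinuousFunction.smul_apply, smul_eq_mul, expBdd_apply, maskB]
  have h : ∀ b ∈ B, expFun (-toReal l) (ifsMap R b x) * expBdd t (ifsMap R b x) =
      expFun (dualMap R l t) x * expFun (toReal b) (dualMap R l t) := by
    intro b _
    rw [expBdd_apply, ← expFun_add_left, expFun_ifsMap, expFun_comm (toReal b), neg_add_eq_sub]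
    rfl
  rw [Finset.sum_congr rfl h, ← Finset.mul_sum]
  ring

theorem norm_sq_integral_conj_le (μ : Measure (Fin d → ℝ)) [IsProbabilityMeasure μ]
    (f : (Fin d → ℝ) →ᵇ ℂ) : ‖∫ x, conj (f x) ∂μ‖ ^ 2 ≤ ∫ x, ‖f x‖ ^ 2 ∂μ := by
  have h1 : ‖∫ x, conj (f x) ∂μ‖ ≤ ∫ x, ‖f x‖ ∂μ := by
    refine (norm_integral_le_integral_norm _).trans_eq ?_
    simp
  have h2 : (∫ x, ‖f x‖ ∂μ) ^ 2 ≤ ∫ x, ‖f x‖ ^ 2 ∂μ :=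
    (even_two.convexOn_pow (𝕜 := ℝ)).map_integral_le (continuous_pow 2).continuousOn isClosed_univ
      (Eventually.of_forall fun _ => Set.mem_univ _) (f.integrable μ).norm (integrable_norm_sq μ f)
  exact (pow_le_pow_left₀ (norm_nonneg _) h1 2).trans h2

/-! ### Splitting off the first letter of a word. -/

section WordEquiv

variable {L : Finset (Fin d → ℤ)}

theorem getLast?_cons_ne {l : Fin d → ℤ} {w : List (Fin d → ℤ)} (h : ¬(l = 0 ∧ w = []))
    (hw : w.getLast? ≠ some 0) : (l :: w).getLast? ≠ some 0 := by
  cases w with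
  | nil => simpa using h
  | cons a w => simpa using hw

/-- The list of letters of a word. -/
def Words.letters (w : Words L) : List (Fin d → ℤ) := w.1

/-- The word with a given list of letters. -/
def Words.ofList (w : List (Fin d → ℤ)) (hw : (∀ l ∈ w, l ∈ L) ∧ w.getLast? ≠ some 0) : Words L :=
  ⟨w, hw⟩

theorem Words.letters_ofList (w : List (Fin d → ℤ))
    (hw : (∀ l ∈ w, l ∈ L) ∧ w.getLast? ≠ some 0) : (Words.ofList w hw).letters = w := rfl

theorem Words.letters_injective : Function.Injective (Words.letters : Words L → _) :=
  Subtype.val_injective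

theorem Words.exists_eq_ofList (w : Words L) : ∃ v hv, w = Words.ofList v hv := ⟨w.1, w.2, rfl⟩

theorem Words.mem_of_mem_letters (w : Words L) {l : Fin d → ℤ} (hl : l ∈ w.letters) : l ∈ L :=
  w.2.1 l hl

theorem Words.getLast?_letters_ne (w : Words L) : w.letters.getLast? ≠ some 0 := w.2.2

/-- Prepend a letter, where prepending `0` to the empty word changes nothing. -/
def consWord (q : L × Words L) : Words L :=
  if h : (q.1 : Fin d → ℤ) = 0 ∧ q.2.letters = [] then q.2
  else .ofList (q.1 :: q.2.letters) ⟨by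
    intro l hl
    rcases List.mem_cons.1 hl with rfl | hl
    · exact q.1.2
    · exact q.2.mem_of_mem_letters hl, getLast?_cons_ne h q.2.getLast?_letters_ne⟩

theorem consWord_of_nil {q : L × Words L} (h : (q.1 : Fin d → ℤ) = 0 ∧ q.2.letters = []) :
    (consWord q).letters = [] := by
  rw [consWord, dif_pos h, h.2]

theorem consWord_of_ne {q : L × Words L} (h : ¬((q.1 : Fin d → ℤ) = 0 ∧ q.2.letters = [])) :
    (consWord q).letters = (q.1 : Fin d → ℤ) :: q.2.letters := by
  rw [consWord, dif_neg h]
  exact Words.letters_ofList _ _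

/-- The list `[0]` is not an admissible word, so the pair `(0, empty)` is free to serve as the
preimage of the empty word. -/
theorem consWord_bijective (hL : (0 : Fin d → ℤ) ∈ L) :
    Function.Bijective (consWord : L × Words L → Words L) := by
  constructor
  · rintro ⟨l, w⟩ ⟨l', w'⟩ h
    have h' := congrArg Words.letters h
    by_cases h1 : (l : Fin d → ℤ) = 0 ∧ w.letters = [] <;> by_cases h2 : (l' : Fin d → ℤ) = 0 ∧ w'.letters = []
    · exact Prod.ext (Subtype.ext (h1.1.trans h2.1.symm)) (Words.letters_injective (h1.2.trans h2.2.symm))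
    · rw [consWord_of_nil h1, consWord_of_ne h2] at h'
      simp at h'
    · rw [consWord_of_ne h1, consWord_of_nil h2] at h'
      simp at h'
    · rw [consWord_of_ne h1, consWord_of_ne h2] at h'
      obtain ⟨h3, h4⟩ := List.cons.inj h'
      exact Prod.ext (Subtype.ext h3) (Words.letters_injective h4)
  · intro v
    obtain ⟨w, hw, rfl⟩ := v.exists_eq_ofList
    cases w with
    | nil => exact ⟨(⟨0, hL⟩, .ofList [] hw), Words.letters_injective (consWord_of_nil ⟨rfl, rfl⟩)⟩
    | cons l w =>
      have hw' : w.getLast? ≠ some 0 := by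
        cases w with
        | nil => simp
        | cons a w => simpa using hw.2
      refine ⟨(⟨l, hw.1 l (by simp)⟩, .ofList w ⟨fun a ha => hw.1 a (by simp [ha]), hw'⟩),
        Words.letters_injective (consWord_of_ne ?_)⟩
      rintro ⟨h1, h2⟩
      simp only [Words.letters_ofList] at h1 h2
      subst h1 h2
      exact hw.2 (by simp)

/-- `L × Ω(L) ≃ Ω(L)`. -/
def wordEquiv (hL : (0 : Fin d → ℤ) ∈ L) : L × Words L ≃ Words L :=
  Equiv.ofBijective consWord (consWord_bijective hL)

theorem length_wordEquiv_le_iff (hL : (0 : Fin d → ℤ) ∈ L) (q : L × Words L) (n : ℕ) :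
    (wordEquiv hL q).letters.length ≤ n + 1 ↔ q.2.letters.length ≤ n := by
  change (consWord q).letters.length ≤ n + 1 ↔ _
  by_cases h : (q.1 : Fin d → ℤ) = 0 ∧ q.2.letters = []
  · simp [consWord_of_nil h, h.2]
  · simp [consWord_of_ne h]

/-- In the exceptional case the lists `[]` and `[0]` have the same frequency, and the same weight
because `α 0 = 1`. -/
theorem wordCoeff_wordEquiv (hL : (0 : Fin d → ℤ) ∈ L) (R : Matrix (Fin d) (Fin d) ℤ)
    {α : (Fin d → ℤ) → ℂ} (h0 : α 0 = 1) (μ : Measure (Fin d → ℝ)) (f : (Fin d → ℝ) →ᵇ ℂ)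
    (q : L × Words L) :
    wordCoeff R α μ f (wordEquiv hL q).letters = wordCoeff R α μ f (q.1 :: q.2.letters) := by
  change wordCoeff R α μ f (consWord q).letters = _
  by_cases h : (q.1 : Fin d → ℤ) = 0 ∧ q.2.letters = []
  · rw [consWord_of_nil h, h.1, h.2]
    simp [wordCoeff, wordFreq_nil, wordFreq_cons, wordWeight, h0]
  · rw [consWord_of_ne h]

end WordEquiv

/-! ### The Bessel inequality for bounded continuous functions. -/

section Bessel

variable {R : Matrix (Fin d) (Fin d) ℤ} {B L : Finset (Fin d → ℤ)} {α : (Fin d → ℤ) → ℂ}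
  {μ : Measure (Fin d → ℝ)} [IsProbabilityMeasure μ]

/-- Removing the first letter replaces `f` by its transfers, whose energies sum to that of `f`, so
the bound survives each induction step. Values in `ℝ≥0∞` spare any summability question. -/
theorem tsum_wordCoeff_length_le (hR : IsExpansive R) (hL : (0 : Fin d → ℤ) ∈ L) (h0 : α 0 = 1)
    (hiso : IsometryCondition R B L α) (hμ : IsSelfAffineMeasure R B μ) (n : ℕ)
    (f : (Fin d → ℝ) →ᵇ ℂ) :
    ∑' w : Words L, (if w.letters.length ≤ n then ENNReal.ofReal (‖wordCoeff R α μ f w.letters‖ ^ 2) else 0) ≤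
      ENNReal.ofReal (∫ x, ‖f x‖ ^ 2 ∂μ) := by
  induction n generalizing f with
  | zero =>
    rw [tsum_eq_single (.ofList [] ⟨by simp, by simp⟩ : Words L)]
    · simp only [Words.letters_ofList, List.length_nil, le_refl, if_true, wordCoeff_nil]
      exact ENNReal.ofReal_le_ofReal (norm_sq_integral_conj_le μ f)
    · intro w hw
      rw [if_neg]
      intro h
      exact hw (Words.letters_injective (List.length_eq_zero_iff.1 (Nat.le_zero.1 h)))
  | succ n ih =>
    rw [← (wordEquiv hL).tsum_eq]
    simp only [length_wordEquiv_le_iff, wordCoeff_wordEquiv hL R h0]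
    refine (ENNReal.tsum_prod (f := fun (l : L) (w : Words L) => if w.letters.length ≤ n then
      ENNReal.ofReal (‖wordCoeff R α μ f (l :: w.letters)‖ ^ 2) else 0)).trans_le ?_
    rw [tsum_fintype]
    calc ∑ l : L, ∑' w : Words L, (if w.letters.length ≤ n then
            ENNReal.ofReal (‖wordCoeff R α μ f (l :: w.letters)‖ ^ 2) else 0)
        ≤ ∑ l : L, ENNReal.ofReal (∫ x, ‖transfer R B α l f x‖ ^ 2 ∂μ) := by
          refine Finset.sum_le_sum fun l _ => ?_
          simp only [← wordCoeff_transfer hR α hμ]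
          exact ih _
      _ = ENNReal.ofReal (∫ x, ‖f x‖ ^ 2 ∂μ) := by
          rw [← ENNReal.ofReal_sum_of_nonneg fun l _ => integral_nonneg fun x => by positivity,
            Finset.sum_coe_sort L (fun l => ∫ x, ‖transfer R B α l f x‖ ^ 2 ∂μ),
            sum_integral_norm_sq_transfer hiso hμ]

theorem sum_norm_sq_wordCoeff_le (hR : IsExpansive R) (hL : (0 : Fin d → ℤ) ∈ L) (h0 : α 0 = 1)
    (hiso : IsometryCondition R B L α) (hμ : IsSelfAffineMeasure R B μ) (F : Finset (Words L))
    (f : (Fin d → ℝ) →ᵇ ℂ) :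
    ∑ w ∈ F, ‖wordCoeff R α μ f w.letters‖ ^ 2 ≤ ∫ x, ‖f x‖ ^ 2 ∂μ := by
  have h := (ENNReal.sum_le_tsum F).trans (tsum_wordCoeff_length_le hR hL h0 hiso hμ
    (F.sup fun w => w.letters.length) f)
  rw [Finset.sum_congr rfl (g := fun w : Words L => ENNReal.ofReal (‖wordCoeff R α μ f w.letters‖ ^ 2))
    fun w hw => if_pos (Finset.le_sup (f := fun w : Words L => w.letters.length) hw),
    ← ENNReal.ofReal_sum_of_nonneg fun w _ => by positivity] at h
  exact (ENNReal.ofReal_le_ofReal_iff (integral_nonneg fun x => by positivity)).1 h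

theorem summable_norm_sq_wordCoeff (hR : IsExpansive R) (hL : (0 : Fin d → ℤ) ∈ L) (h0 : α 0 = 1)
    (hiso : IsometryCondition R B L α) (hμ : IsSelfAffineMeasure R B μ)
    (f : (Fin d → ℝ) →ᵇ ℂ) : Summable fun w : Words L => ‖wordCoeff R α μ f w.letters‖ ^ 2 :=
  summable_of_sum_le (fun _ => by positivity)
    fun F => sum_norm_sq_wordCoeff_le hR hL h0 hiso hμ F f

theorem tsum_norm_sq_wordCoeff_eq (hR : IsExpansive R) (hL : (0 : Fin d → ℤ) ∈ L) (h0 : α 0 = 1)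
    (hiso : IsometryCondition R B L α) (hμ : IsSelfAffineMeasure R B μ)
    (f : (Fin d → ℝ) →ᵇ ℂ) :
    ∑' w : Words L, ‖wordCoeff R α μ f w.letters‖ ^ 2 =
      ∑ l ∈ L, ∑' w : Words L, ‖wordCoeff R α μ (transfer R B α l f) w.letters‖ ^ 2 := by
  have hs := (wordEquiv hL).summable_iff.2 (summable_norm_sq_wordCoeff hR hL h0 hiso hμ f)
  rw [← (wordEquiv hL).tsum_eq, ← Finset.sum_coe_sort L]
  have h1 := hs.tsum_prod
  simp only [Function.comp_def] at h1
  rw [h1, tsum_fintype]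
  simp only [wordCoeff_wordEquiv hL R h0, wordCoeff_transfer hR α hμ]

end Bessel

/-! ### Bessel families in Hilbert space and the frame operator. -/

section BesselFamily

variable {ι H : Type*} [NormedAddCommGroup H] [InnerProductSpace ℂ H]

/-- A Bessel family with bound `1`. -/
def IsBesselFamily (e : ι → H) : Prop :=
  ∀ (F : Finset ι) (v : H), ∑ i ∈ F, ‖inner ℂ v (e i)‖ ^ 2 ≤ ‖v‖ ^ 2

theorem IsBesselFamily.memlp {e : ι → H} (he : IsBesselFamily e) (v : H) :
    Memℓp (fun i => inner ℂ (e i) v) 2 := by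
  refine memℓp_gen' (C := ‖v‖ ^ 2) fun F => ?_
  refine le_trans (le_of_eq (Finset.sum_congr rfl fun i _ => ?_)) (he F v)
  rw [norm_inner_symm]
  simp

/-- The analysis operator of a Bessel family. -/
def IsBesselFamily.analysis {e : ι → H} (he : IsBesselFamily e) : H →L[ℂ] lp (fun _ : ι => ℂ) 2 :=
  LinearMap.mkContinuous
    { toFun := fun v => ⟨fun i => inner ℂ (e i) v, he.memlp v⟩
      map_add' := fun u v => by
        ext i
        exact inner_add_right _ _ _
      map_smul' := fun c v => by
        ext i
        exact inner_smul_right _ _ _ } 1 fun v => by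
    rw [one_mul]
    refine lp.norm_le_of_forall_sum_le (by norm_num) (norm_nonneg _) fun F => ?_
    refine le_trans (le_of_eq (Finset.sum_congr rfl fun i _ => ?_)) ((he F v).trans_eq ?_)
    · rw [norm_inner_symm]
      simp
    · simp

theorem IsBesselFamily.norm_analysis_le {e : ι → H} (he : IsBesselFamily e) (v : H) :
    ‖he.analysis v‖ ≤ ‖v‖ := by
  refine (ContinuousLinearMap.le_opNorm _ v).trans ?_
  refine mul_le_of_le_one_left (norm_nonneg _) ?_
  exact LinearMap.mkContinuous_norm_le _ zero_le_one _

theorem IsBesselFamily.hasSum_norm_sq {e : ι → H} (he : IsBesselFamily e) (v : H) :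
    HasSum (fun i => ‖inner ℂ v (e i)‖ ^ 2) (‖he.analysis v‖ ^ 2) := by
  have h := lp.hasSum_norm (p := 2) (by norm_num) (he.analysis v)
  simp only [ENNReal.toReal_ofNat, Real.rpow_ofNat] at h
  convert! h using 3 with i
  rw [norm_inner_symm]
  rfl

variable [CompleteSpace H]

/-- The frame operator of a Bessel family. -/
def IsBesselFamily.frameOp {e : ι → H} (he : IsBesselFamily e) : H →L[ℂ] H :=
  (ContinuousLinearMap.adjoint he.analysis).comp he.analysis

theorem IsBesselFamily.inner_frameOp_self {e : ι → H} (he : IsBesselFamily e) (v : H) :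
    inner ℂ v (he.frameOp v) = ((‖he.analysis v‖ ^ 2 : ℝ) : ℂ) := by
  rw [frameOp, ContinuousLinearMap.comp_apply, ContinuousLinearMap.adjoint_inner_right,
    inner_self_eq_norm_sq_to_K]
  push_cast
  rfl

theorem IsBesselFamily.norm_frameOp_le {e : ι → H} (he : IsBesselFamily e) (v : H) :
    ‖he.frameOp v‖ ≤ ‖v‖ := by
  have h1 : ‖ContinuousLinearMap.adjoint he.analysis‖ ≤ 1 := by
    rw [LinearIsometryEquiv.norm_map]
    exact LinearMap.mkContinuous_norm_le _ zero_le_one _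
  calc ‖he.frameOp v‖ ≤ ‖ContinuousLinearMap.adjoint he.analysis‖ * ‖he.analysis v‖ :=
        (ContinuousLinearMap.adjoint he.analysis).le_opNorm _
    _ ≤ 1 * ‖v‖ := by
        gcongr
        exact he.norm_analysis_le v
    _ = ‖v‖ := one_mul _

/-- Equality case of a contraction: with `S` the frame operator, `‖v - S v‖² = ‖v‖² - 2 Re ⟨v, S v⟩
+ ‖S v‖²`, where `⟨v, S v⟩ = ‖v‖²` and `‖S v‖ ≤ ‖v‖`. -/
theorem IsBesselFamily.frameOp_eq_self {e : ι → H} (he : IsBesselFamily e) {v : H}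
    (hv : HasSum (fun i => ‖inner ℂ v (e i)‖ ^ 2) (‖v‖ ^ 2)) : he.frameOp v = v := by
  have h1 : ‖he.analysis v‖ ^ 2 = ‖v‖ ^ 2 := (he.hasSum_norm_sq v).unique hv
  have h2 := @norm_sub_sq ℂ H _ _ _ v (he.frameOp v)
  rw [he.inner_frameOp_self, h1] at h2
  have h3 : ‖he.frameOp v‖ ^ 2 ≤ ‖v‖ ^ 2 :=
    pow_le_pow_left₀ (norm_nonneg _) (he.norm_frameOp_le v) 2
  have h4 : RCLike.re (((‖v‖ ^ 2 : ℝ) : ℂ)) = ‖v‖ ^ 2 := Complex.ofReal_re _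
  rw [h4] at h2
  have h5 : ‖v - he.frameOp v‖ ^ 2 ≤ 0 := by linarith
  have h6 : ‖v - he.frameOp v‖ = 0 := by
    have := sq_nonneg ‖v - he.frameOp v‖
    exact pow_eq_zero_iff two_ne_zero |>.1 (le_antisymm h5 this)
  exact (sub_eq_zero.1 (norm_eq_zero.1 h6)).symm

/-- The Parseval identity is quadratic and does not pass to linear spans by itself; the linear
condition that the frame operator fixes `v` does. -/
theorem IsBesselFamily.isParsevalFrame {e : ι → H} (he : IsBesselFamily e) {S : Set H}
    (hS : (Submodule.span ℂ S).topologicalClosure = ⊤)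
    (hv : ∀ v ∈ S, HasSum (fun i => ‖inner ℂ v (e i)‖ ^ 2) (‖v‖ ^ 2)) : IsParsevalFrame e := by
  have h1 : he.frameOp = ContinuousLinearMap.id ℂ H := by
    refine ContinuousLinearMap.ext_on (s := S) ?_ fun v hvS => he.frameOp_eq_self (hv v hvS)
    exact Submodule.dense_iff_topologicalClosure_eq_top.2 hS
  intro v
  have h2 := he.inner_frameOp_self v
  rw [h1, ContinuousLinearMap.id_apply, inner_self_eq_norm_sq_to_K] at h2
  have h3 : ‖v‖ ^ 2 = ‖he.analysis v‖ ^ 2 := by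
    rw [← RCLike.ofReal_pow] at h2
    exact Complex.ofReal_injective h2
  rw [h3]
  exact he.hasSum_norm_sq v

end BesselFamily

/-! ### Passage to `L²(μ)` and the frame function. -/

section Lp

variable {μ : Measure (Fin d → ℝ)} [IsProbabilityMeasure μ]

/-- A bounded continuous function as an element of `L²(μ)`. -/
def toL2 (μ : Measure (Fin d → ℝ)) [IsProbabilityMeasure μ] :
    ((Fin d → ℝ) →ᵇ ℂ) →L[ℂ] Lp ℂ 2 μ :=
  BoundedContinuousFunction.toLp 2 μ ℂ

theorem coeFn_toL2 (f : (Fin d → ℝ) →ᵇ ℂ) : toL2 μ f =ᵐ[μ] f :=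
  BoundedContinuousFunction.coeFn_toLp 2 μ ℂ f

theorem denseRange_toL2 : DenseRange (toL2 μ) :=
  BoundedContinuousFunction.toLp_denseRange ℂ μ ℂ (by norm_num)

theorem norm_toL2_sq (f : (Fin d → ℝ) →ᵇ ℂ) : ‖toL2 μ f‖ ^ 2 = ∫ x, ‖f x‖ ^ 2 ∂μ := by
  have h := @inner_self_eq_norm_sq_to_K ℂ (Lp ℂ 2 μ) _ _ _ (toL2 μ f)
  rw [L2.inner_def] at h
  have h2 : ∫ x, inner ℂ (toL2 μ f x) (toL2 μ f x) ∂μ = ((∫ x, ‖f x‖ ^ 2 ∂μ : ℝ) : ℂ) := by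
    rw [← integral_complex_ofReal]
    refine integral_congr_ae ?_
    filter_upwards [coeFn_toL2 (μ := μ) f] with x hx
    rw [hx, inner_self_eq_norm_sq_to_K]
    push_cast
    rfl
  rw [h2, ← RCLike.ofReal_pow] at h
  exact (Complex.ofReal_injective h).symm

theorem norm_toL2_expBdd (t : Fin d → ℝ) : ‖toL2 μ (expBdd t)‖ ^ 2 = 1 := by
  rw [norm_toL2_sq]
  simp [norm_expFun]

theorem inner_toL2_weightedExp (R : Matrix (Fin d) (Fin d) ℤ) (L : Finset (Fin d → ℤ))
    (α : (Fin d → ℤ) → ℂ) (f : (Fin d → ℝ) →ᵇ ℂ) (w : Words L) :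
    inner ℂ (toL2 μ f) (weightedExp R L α μ w) = wordCoeff R α μ f w.letters := by
  rw [L2.inner_def, wordCoeff]
  refine integral_congr_ae ?_
  filter_upwards [coeFn_toL2 (μ := μ) f, MemLp.coeFn_toLp (memLp_const_mul_expFun μ
    (wordWeight α w.letters) (toReal (wordFreq R w.letters)))] with x hx hx'
  rw [hx, weightedExp]
  erw [hx']
  rw [RCLike.inner_apply, mul_comm]

variable {R : Matrix (Fin d) (Fin d) ℤ} {B L : Finset (Fin d → ℤ)} {α : (Fin d → ℤ) → ℂ}

theorem isBesselFamily_weightedExp (hR : IsExpansive R) (hL : (0 : Fin d → ℤ) ∈ L) (h0 : α 0 = 1)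
    (hiso : IsometryCondition R B L α) (hμ : IsSelfAffineMeasure R B μ) :
    IsBesselFamily (weightedExp R L α μ) := by
  intro F v
  refine denseRange_toL2.induction_on (p := fun v => ∑ i ∈ F,
    ‖inner ℂ v (weightedExp R L α μ i)‖ ^ 2 ≤ ‖v‖ ^ 2) v ?_ fun f => ?_
  · exact isClosed_le (by fun_prop) (by fun_prop)
  · rw [norm_toL2_sq]
    simp only [inner_toL2_weightedExp]
    exact sum_norm_sq_wordCoeff_le hR hL h0 hiso hμ F f

/-- The function `h(t) = ∑_w |⟨e_t, ψ_w⟩|²`. -/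
def frameFun (R : Matrix (Fin d) (Fin d) ℤ) (L : Finset (Fin d → ℤ)) (α : (Fin d → ℤ) → ℂ)
    (μ : Measure (Fin d → ℝ)) (t : Fin d → ℝ) : ℝ :=
  ∑' w : Words L, ‖wordCoeff R α μ (expBdd t) w.letters‖ ^ 2

theorem frameFun_eq_norm_sq (he : IsBesselFamily (weightedExp R L α μ)) (t : Fin d → ℝ) :
    frameFun R L α μ t = ‖he.analysis (toL2 μ (expBdd t))‖ ^ 2 := by
  rw [← (he.hasSum_norm_sq _).tsum_eq, frameFun]
  simp only [inner_toL2_weightedExp]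

end Lp

/-! ### Entire extension of quadratic forms at exponentials. -/

section Entire

/-- The `i`-th coordinate truncated to `[-r, r]`. -/
def truncCoord (r : ℝ) (i : Fin d) : (Fin d → ℝ) →ᵇ ℂ :=
  BoundedContinuousFunction.ofNormedAddCommGroup (fun x => ((max (-|r|) (min (x i) |r|) : ℝ) : ℂ))
    (by fun_prop) |r| fun x => by
      rw [Complex.norm_real, Real.norm_eq_abs, abs_le]
      refine ⟨le_max_left _ _, max_le ?_ (min_le_right _ _)⟩
      linarith [abs_nonneg r]

theorem truncCoord_apply {r : ℝ} {x : Fin d → ℝ} (hx : ‖x‖ ≤ r) (i : Fin d) :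
    truncCoord r i x = (x i : ℂ) := by
  have h1 : |x i| ≤ |r| := ((norm_le_pi_norm x i).trans hx).trans (le_abs_self r)
  obtain ⟨h2, h3⟩ := abs_le.1 h1
  change ((max (-|r|) (min (x i) |r|) : ℝ) : ℂ) = _
  rw [min_eq_left h3, max_eq_right h2]

/-- A bounded version of `x ↦ exp(2π i z·x)` for `z ∈ ℂ^d`. -/
def truncExp (r : ℝ) (z : Fin d → ℂ) : (Fin d → ℝ) →ᵇ ℂ :=
  NormedSpace.exp (∑ i, (2 * Real.pi * Complex.I * z i) • truncCoord r i)

theorem differentiable_truncExp (r : ℝ) : Differentiable ℂ (truncExp r : (Fin d → ℂ) → _) := by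
  have h1 : Differentiable ℂ fun z : Fin d → ℂ =>
      ∑ i, (2 * Real.pi * Complex.I * z i) • truncCoord r i := by
    fun_prop
  have h2 : Differentiable ℂ (NormedSpace.exp : ((Fin d → ℝ) →ᵇ ℂ) → _) := fun f =>
    (hasFDerivAt_exp (𝕂 := ℂ) (x := f)).differentiableAt
  exact h2.comp h1

theorem truncExp_apply (r : ℝ) (z : Fin d → ℂ) (x : Fin d → ℝ) :
    truncExp r z x = Complex.exp (∑ i, (2 * Real.pi * Complex.I * z i) * truncCoord r i x) := by
  let ev : ((Fin d → ℝ) →ᵇ ℂ) →+* ℂ :=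
    { toFun := fun f => f x
      map_one' := rfl
      map_mul' := fun _ _ => rfl
      map_zero' := rfl
      map_add' := fun _ _ => rfl }
  have hev : Continuous ev := (BoundedContinuousFunction.evalCLM ℂ x).continuous
  have h := NormedSpace.map_exp ev hev (∑ i, (2 * Real.pi * Complex.I * z i) • truncCoord r i)
  rw [← Complex.exp_eq_exp_ℂ, map_sum] at h
  exact h

theorem truncExp_toComplex {r : ℝ} (t : Fin d → ℝ) {x : Fin d → ℝ} (hx : ‖x‖ ≤ r) :
    truncExp r (toComplex t) x = expFun t x := by
  rw [truncExp_apply, expFun]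
  congr 1
  simp only [truncCoord_apply hx, toComplex, dotProduct]
  push_cast
  rw [Finset.mul_sum]
  exact Finset.sum_congr rfl fun i _ => by ring

variable {μ : Measure (Fin d → ℝ)} [IsProbabilityMeasure μ]

theorem toL2_congr {f g : (Fin d → ℝ) →ᵇ ℂ} (h : f =ᵐ[μ] g) : toL2 μ f = toL2 μ g :=
  Lp.ext ((coeFn_toL2 f).trans (h.trans (coeFn_toL2 g).symm))

/-- Quadratic forms of a bounded operator at the exponentials extend to entire functions. -/
theorem exists_entire_inner_expBdd {r : ℝ} (hr : ∀ᵐ x ∂μ, ‖x‖ ≤ r)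
    (A : Lp ℂ 2 μ →L[ℂ] Lp ℂ 2 μ) :
    ∃ h : (Fin d → ℂ) → ℂ, Differentiable ℂ h ∧
      ∀ t, h (toComplex t) = inner ℂ (toL2 μ (expBdd t)) (A (toL2 μ (expBdd t))) := by
  -- The `star` cancels the conjugate-linearity of the inner product. Evaluating `P` at `truncExp r
  -- (-z)` then extends `conj e_t = e_{-t}` holomorphically.
  let P : ((Fin d → ℝ) →ᵇ ℂ) →L[ℂ] Lp ℂ 2 μ →L[ℂ] ℂ :=
    (innerSL ℂ).comp ((toL2 μ).comp (starL ℂ).toContinuousLinearMap)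
  have hP : ∀ f u, P f u = inner ℂ (toL2 μ (star f)) u := fun f u => rfl
  refine ⟨fun z => P (truncExp r (-z)) (A (toL2 μ (truncExp r z))), ?_, fun t => ?_⟩
  · have h1 : Differentiable ℂ fun z : Fin d → ℂ => P (truncExp r (-z)) :=
      P.differentiable.comp ((differentiable_truncExp r).comp differentiable_id.neg)
    have h2 : Differentiable ℂ fun z : Fin d → ℂ => A (toL2 μ (truncExp r z)) :=
      (A.differentiable.comp (toL2 μ).differentiable).comp (differentiable_truncExp r)
    exact h1.clm_apply h2
  · have h3 : toL2 μ (truncExp r (toComplex t)) = toL2 μ (expBdd t) := by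
      refine toL2_congr ?_
      filter_upwards [hr] with x hx
      exact truncExp_toComplex t hx
    have h4 : toL2 μ (star (truncExp r (-toComplex t))) = toL2 μ (expBdd t) := by
      refine toL2_congr ?_
      filter_upwards [hr] with x hx
      have h5 : -toComplex t = toComplex (-t) := by
        ext i
        simp [toComplex]
      rw [BoundedContinuousFunction.star_apply, h5, truncExp_toComplex _ hx, RCLike.star_def,
        conj_expFun, neg_neg]
      rfl
    simp only [hP, h3, h4]

end Entire

/-! ### Density of trigonometric polynomials in `L²(μ)`. -/

section Density

/-- The exponential `e_t` restricted to a ball. -/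
def expBall (r : ℝ) (t : Fin d → ℝ) : C(Metric.closedBall (0 : Fin d → ℝ) r, ℂ) :=
  ⟨fun x => expFun t x, (continuous_expFun t).comp continuous_subtype_val⟩

/-- The star subalgebra of trigonometric polynomials on a ball. -/
def trigPoly (d : ℕ) (r : ℝ) : StarSubalgebra ℂ C(Metric.closedBall (0 : Fin d → ℝ) r, ℂ) where
  toSubalgebra := Algebra.adjoin ℂ (Set.range (expBall r))
  star_mem' := by
    change Algebra.adjoin ℂ (Set.range (expBall r)) ≤ star (Algebra.adjoin ℂ (Set.range (expBall r)))
    refine Algebra.adjoin_le ?_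
    rintro - ⟨t, rfl⟩
    refine Algebra.subset_adjoin ⟨-t, ?_⟩
    ext x
    exact (conj_expFun t x).symm

theorem coe_trigPoly (r : ℝ) : Subalgebra.toSubmodule (trigPoly d r).toSubalgebra =
    Submodule.span ℂ (Set.range (expBall r)) := by
  apply Algebra.adjoin_eq_span_of_subset
  refine Set.Subset.trans ?_ Submodule.subset_span
  intro x hx
  refine Submonoid.closure_induction (fun _ => id) ⟨0, ?_⟩ ?_ hx
  · ext1 z
    exact expFun_zero_left _
  · rintro - - - - ⟨s, rfl⟩ ⟨t, rfl⟩
    refine ⟨s + t, ?_⟩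
    ext1 z
    exact expFun_add_left s t z

theorem exists_expFun_ne {x y : Fin d → ℝ} (h : x ≠ y) : ∃ t, expFun t x ≠ expFun t y := by
  obtain ⟨i, hi⟩ := Function.ne_iff.1 h
  have hi' : x i - y i ≠ 0 := sub_ne_zero.2 hi
  -- This frequency has `t · (x - y) = 1/2`, so the two values differ by the factor `-1`.
  refine ⟨Pi.single i (1 / (2 * (x i - y i))), fun heq => ?_⟩
  set t : Fin d → ℝ := Pi.single i (1 / (2 * (x i - y i))) with ht
  have h1 : expFun t (x - y) = -1 := by
    have h2 : t ⬝ᵥ (x - y) = 1 / 2 := by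
      rw [ht, single_dotProduct, Pi.sub_apply]
      field_simp
    rw [expFun_eq, h2, ← Complex.exp_pi_mul_I]
    congr 3
    ring
  have h3 : expFun t x = expFun t (x - y) * expFun t y := by
    rw [← expFun_add_right, sub_add_cancel]
  have h4 : expFun t y ≠ 0 := Complex.exp_ne_zero _
  rw [h1, heq, neg_one_mul, self_eq_neg] at h3
  exact h4 h3

/-- Stone–Weierstrass; the algebra generated by the exponentials is already their linear span, as
they are closed under products. -/
theorem dense_span_expBall (r : ℝ) :
    Dense (Submodule.span ℂ (Set.range (expBall (d := d) r)) :
      Set C(Metric.closedBall (0 : Fin d → ℝ) r, ℂ)) := by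
  have hsep : (trigPoly d r).SeparatesPoints := by
    intro x y hxy
    obtain ⟨t, ht⟩ := exists_expFun_ne (fun h => hxy (Subtype.ext h))
    exact ⟨expBall r t, ⟨expBall r t, Algebra.subset_adjoin ⟨t, rfl⟩, rfl⟩, ht⟩
  have h := ContinuousMap.starSubalgebra_topologicalClosure_eq_top_of_separatesPoints _ hsep
  rw [← coe_trigPoly]
  have h2 := congrArg (fun A : StarSubalgebra ℂ C(Metric.closedBall (0 : Fin d → ℝ) r, ℂ) =>
    (A : Set C(Metric.closedBall (0 : Fin d → ℝ) r, ℂ))) h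
  simp only [StarSubalgebra.topologicalClosure_coe] at h2
  exact dense_iff_closure_eq.2 h2

variable {μ : Measure (Fin d → ℝ)} [IsProbabilityMeasure μ]

theorem exists_span_expBdd_near {r : ℝ} (f : (Fin d → ℝ) →ᵇ ℂ) {ε : ℝ} (hε : 0 < ε) :
    ∃ g ∈ Submodule.span ℂ (Set.range (expBdd (d := d))), ∀ x, ‖x‖ ≤ r → ‖f x - g x‖ ≤ ε := by
  let ρ : ((Fin d → ℝ) →ᵇ ℂ) →ₗ[ℂ] C(Metric.closedBall (0 : Fin d → ℝ) r, ℂ) :=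
    { toFun := fun f => ⟨fun x => f x, f.continuous.comp continuous_subtype_val⟩
      map_add' := fun _ _ => rfl
      map_smul' := fun _ _ => rfl }
  obtain ⟨q, hq, hqε⟩ := Metric.dense_iff.1 (dense_span_expBall r) (ρ f) ε hε
  have h1 : Submodule.span ℂ (Set.range (expBall (d := d) r)) =
      (Submodule.span ℂ (Set.range (expBdd (d := d)))).map ρ := by
    rw [Submodule.map_span, ← Set.range_comp]
    rfl
  rw [SetLike.mem_coe, h1] at hqε
  obtain ⟨g, hg, rfl⟩ := hqε
  refine ⟨g, hg, fun x hx => ?_⟩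
  have h2 := ContinuousMap.norm_coe_le_norm (ρ f - ρ g) ⟨x, by simpa using hx⟩
  rw [Metric.mem_ball, dist_comm, dist_eq_norm] at hq
  exact h2.trans hq.le

theorem topologicalClosure_span_toL2_expBdd {r : ℝ} (hr : ∀ᵐ x ∂μ, ‖x‖ ≤ r) :
    (Submodule.span ℂ (Set.range fun t => toL2 μ (expBdd (d := d) t))).topologicalClosure = ⊤ := by
  rw [← Submodule.dense_iff_topologicalClosure_eq_top]
  refine Dense.of_closure (denseRange_toL2.mono ?_)
  rintro - ⟨f, rfl⟩
  rw [Metric.mem_closure_iff]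
  intro ε hε
  obtain ⟨g, hg, hgf⟩ := exists_span_expBdd_near (r := r) f (half_pos hε)
  refine ⟨toL2 μ g, ?_, ?_⟩
  · have h1 : Submodule.span ℂ (Set.range fun t => toL2 μ (expBdd (d := d) t)) =
        (Submodule.span ℂ (Set.range (expBdd (d := d)))).map (toL2 μ).toLinearMap := by
      rw [Submodule.map_span, ← Set.range_comp]
      rfl
    rw [SetLike.mem_coe, h1]
    exact ⟨g, hg, rfl⟩
  · rw [dist_eq_norm, ← map_sub]
    have h2 : ‖toL2 μ (f - g)‖ ^ 2 ≤ (ε / 2) ^ 2 := by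
      rw [norm_toL2_sq]
      calc ∫ x, ‖(f - g) x‖ ^ 2 ∂μ ≤ ∫ _, (ε / 2) ^ 2 ∂μ := by
            refine integral_mono_ae (integrable_norm_sq μ _) (integrable_const _) ?_
            filter_upwards [hr] with x hx
            exact pow_le_pow_left₀ (norm_nonneg _) (hgf x hx) 2
        _ = (ε / 2) ^ 2 := by simp
    have h3 := (sq_le_sq₀ (norm_nonneg _) (half_pos hε).le).1 h2
    linarith

end Density

/-! ### The functional equation, positivity and the minimum principle. -/

section FrameFun

variable {R : Matrix (Fin d) (Fin d) ℤ} {B L : Finset (Fin d → ℤ)} {α : (Fin d → ℤ) → ℂ}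
  {μ : Measure (Fin d → ℝ)} [IsProbabilityMeasure μ]

theorem wordCoeff_smul (R : Matrix (Fin d) (Fin d) ℤ) (α : (Fin d → ℤ) → ℂ)
    (μ : Measure (Fin d → ℝ)) (c : ℂ) (f : (Fin d → ℝ) →ᵇ ℂ) (w : List (Fin d → ℤ)) :
    wordCoeff R α μ (c • f) w = conj c * wordCoeff R α μ f w := by
  unfold wordCoeff
  rw [← integral_const_mul]
  congr 1
  funext x
  rw [BoundedContinuousFunction.smul_apply, smul_eq_mul, map_mul]
  ring

theorem norm_wordCoeff_expBdd_cons (hR : IsExpansive R) (hμ : IsSelfAffineMeasure R B μ)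
    (t : Fin d → ℝ) (l : Fin d → ℤ) (w : List (Fin d → ℤ)) :
    ‖wordCoeff R α μ (expBdd t) (l :: w)‖ =
      ‖α l‖ * ‖maskB B (dualMap R l t)‖ * ‖wordCoeff R α μ (expBdd (dualMap R l t)) w‖ := by
  rw [← wordCoeff_transfer hR α hμ, transfer_expBdd, wordCoeff_smul, norm_mul, Complex.norm_conj,
    norm_mul, Complex.norm_conj]

/-- This is the energy identity for `transfer` applied to `e_t`. -/
theorem sum_weights_eq_one (hiso : IsometryCondition R B L α) (hμ : IsSelfAffineMeasure R B μ)
    (t : Fin d → ℝ) : ∑ l ∈ L, ‖α l‖ ^ 2 * ‖maskB B (dualMap R l t)‖ ^ 2 = 1 := by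
  have h := sum_integral_norm_sq_transfer hiso hμ (expBdd t)
  simp only [transfer_expBdd, BoundedContinuousFunction.smul_apply, smul_eq_mul, expBdd_apply,
    norm_mul, norm_expFun, Complex.norm_conj, mul_one, integral_const, probReal_univ,
    one_pow, mul_pow, one_mul] at h
  exact h

theorem frameFun_nonneg (ν : Measure (Fin d → ℝ)) (t : Fin d → ℝ) : 0 ≤ frameFun R L α ν t :=
  tsum_nonneg fun _ => by positivity

theorem frameFun_le_one (he : IsBesselFamily (weightedExp R L α μ)) (t : Fin d → ℝ) :
    frameFun R L α μ t ≤ 1 := by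
  rw [frameFun_eq_norm_sq he, ← norm_toL2_expBdd (μ := μ) t]
  exact pow_le_pow_left₀ (norm_nonneg _) (he.norm_analysis_le _) 2

theorem frameFun_ruelle (hR : IsExpansive R) (hL : (0 : Fin d → ℤ) ∈ L) (h0 : α 0 = 1)
    (hiso : IsometryCondition R B L α) (hμ : IsSelfAffineMeasure R B μ) (t : Fin d → ℝ) :
    ∑ l ∈ L, ‖α l‖ ^ 2 * ‖maskB B (dualMap R l t)‖ ^ 2 * frameFun R L α μ (dualMap R l t) =
      frameFun R L α μ t := by
  unfold frameFun
  rw [tsum_norm_sq_wordCoeff_eq hR hL h0 hiso hμ]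
  refine Finset.sum_congr rfl fun l _ => ?_
  rw [← tsum_mul_left]
  congr 1
  funext w
  rw [wordCoeff_transfer hR α hμ, norm_wordCoeff_expBdd_cons hR hμ, mul_pow, mul_pow]

theorem frameFun_zero (hR : IsExpansive R) (hL : (0 : Fin d → ℤ) ∈ L) (h0 : α 0 = 1)
    (hiso : IsometryCondition R B L α) (hμ : IsSelfAffineMeasure R B μ) :
    frameFun R L α μ 0 = 1 := by
  refine le_antisymm (frameFun_le_one (isBesselFamily_weightedExp hR hL h0 hiso hμ) 0) ?_
  have h := (summable_norm_sq_wordCoeff hR hL h0 hiso hμ (expBdd 0)).le_tsum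
    (Words.ofList [] ⟨by simp, by simp⟩) (fun _ _ => by positivity)
  refine le_trans (le_of_eq ?_) h
  change 1 = ‖wordCoeff R α μ (expBdd 0) []‖ ^ 2
  simp [wordCoeff_nil]

theorem exists_entire_frameFun (hR : IsExpansive R) (hB : B.Nonempty)
    (he : IsBesselFamily (weightedExp R L α μ)) (hμ : IsSelfAffineMeasure R B μ) :
    ∃ h : (Fin d → ℂ) → ℂ, Differentiable ℂ h ∧
      ∀ t, h (toComplex t) = (frameFun R L α μ t : ℂ) := by
  obtain ⟨r, hr⟩ := hμ.exists_ae_norm_le hR hB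
  obtain ⟨h, hd, hh⟩ := exists_entire_inner_expBdd hr he.frameOp
  refine ⟨h, hd, fun t => ?_⟩
  rw [hh, he.inner_frameOp_self, frameFun_eq_norm_sq he]

theorem continuous_frameFun (hR : IsExpansive R) (hB : B.Nonempty)
    (he : IsBesselFamily (weightedExp R L α μ)) (hμ : IsSelfAffineMeasure R B μ) :
    Continuous (frameFun R L α μ) := by
  obtain ⟨h, hd, hh⟩ := exists_entire_frameFun hR hB he hμ
  have hc : Continuous (toComplex : (Fin d → ℝ) → Fin d → ℂ) :=
    continuous_pi fun i => Complex.continuous_ofReal.comp (continuous_apply i)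
  have h1 := Complex.continuous_re.comp (hd.continuous.comp hc)
  refine h1.congr fun t => ?_
  simp only [Function.comp_apply, hh, Complex.ofReal_re]

theorem frameFun_eq_one_of_uniqueness (hR : IsExpansive R) (hB : B.Nonempty)
    (hL : (0 : Fin d → ℤ) ∈ L) (h0 : α 0 = 1) (hiso : IsometryCondition R B L α)
    (huniq : UniquenessCondition R B L α) (hμ : IsSelfAffineMeasure R B μ) (t : Fin d → ℝ) :
    frameFun R L α μ t = 1 := by
  have he := isBesselFamily_weightedExp hR hL h0 hiso hμ
  obtain ⟨h, hd, hh⟩ := exists_entire_frameFun hR hB he hμ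
  have h1 := huniq h hd (fun t => ⟨_, frameFun_nonneg μ t, frameFun_le_one he t, hh t⟩) ?_ ?_
    (toComplex t)
  · rw [hh] at h1
    exact_mod_cast h1
  · have h2 := hh 0
    rw [frameFun_zero hR hL h0 hiso hμ] at h2
    convert! h2 using 2
  · intro s
    rw [hh, ← frameFun_ruelle hR hL h0 hiso hμ s]
    simp only [hh]
    push_cast
    rfl

theorem frameFun_pos_of_subset {L' : Finset (Fin d → ℤ)} {ν : Measure (Fin d → ℝ)} (hLL' : L ⊆ L')
    {α' : (Fin d → ℤ) → ℂ} (hne : ∀ l ∈ L', α' l ≠ 0) {t : Fin d → ℝ}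
    (hs : Summable fun w : Words L' => ‖wordCoeff R α' ν (expBdd t) w.letters‖ ^ 2)
    (h : 0 < frameFun R L α ν t) : 0 < frameFun R L' α' ν t := by
  refine lt_of_le_of_ne (frameFun_nonneg ν t) fun h0 => h.ne' ?_
  -- Summability rules out that `0` is merely the default value of `tsum`.
  have hs0 : HasSum (fun w : Words L' => ‖wordCoeff R α' ν (expBdd t) w.letters‖ ^ 2) 0 := by
    rw [h0]
    exact hs.hasSum
  have h1 := (hasSum_zero_iff_of_nonneg (fun w => by positivity)).1 hs0
  have h2 : ∀ w : Words L, wordCoeff R α ν (expBdd t) w.letters = 0 := by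
    intro w
    have hw : ∀ l ∈ w.letters, l ∈ L' := fun l hl => hLL' (w.mem_of_mem_letters hl)
    have h3 := congrFun h1 (Words.ofList w.letters ⟨hw, w.getLast?_letters_ne⟩)
    simp only [Words.letters_ofList, Pi.zero_apply, ne_eq, OfNat.ofNat_ne_zero, not_false_eq_true,
      pow_eq_zero_iff, norm_eq_zero] at h3
    have h4 : wordWeight α' w.letters ≠ 0 := by
      refine List.prod_ne_zero fun hmem => ?_
      obtain ⟨l, hl, hl0⟩ := List.mem_map.1 hmem
      exact hne l (hw l hl) hl0
    have h5 : ∀ β : (Fin d → ℤ) → ℂ, wordCoeff R β ν (expBdd t) w.letters =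
        wordWeight β w.letters *
          ∫ x, conj (expBdd t x) * expFun (toReal (wordFreq R w.letters)) x ∂ν := by
      intro β
      rw [wordCoeff, ← integral_const_mul]
      congr 1
      funext x
      ring
    rw [h5] at h3 ⊢
    rw [(mul_eq_zero.1 h3).resolve_left h4, mul_zero]
  simp [frameFun, h2]

theorem dualMap_zero (R : Matrix (Fin d) (Fin d) ℤ) (t : Fin d → ℝ) :
    dualMap R 0 t = (realMat R)ᵀ⁻¹ *ᵥ t := by
  rw [dualMap, toReal_zero, sub_zero]

/-- If the frame function has no zeros, its minimum over a compact set that is invariant under the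
maps `g_l` is attained at `0`, so that it is constant. -/
theorem frameFun_eq_one_of_pos (hR : IsExpansive R) (hB : B.Nonempty)
    (hL : (0 : Fin d → ℤ) ∈ L) (h0 : α 0 = 1) (hiso : IsometryCondition R B L α)
    (hμ : IsSelfAffineMeasure R B μ) (hpos : ∀ t, 0 < frameFun R L α μ t) (t : Fin d → ℝ) :
    frameFun R L α μ t = 1 := by
  have he := isBesselFamily_weightedExp hR hL h0 hiso hμ
  have hcont := continuous_frameFun hR hB he hμ
  obtain ⟨p, hpc, hpn, r, θ, hθ0, hθ1, hp⟩ := exists_affine_contracting_gauge _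
    (tendsto_inv_realMat_transpose_pow hR) (L.image fun l => -toReal l)
  -- Large enough for `t ∈ X`, and nonnegative so that `θ * u ≤ u` makes `X` invariant.
  set u := |p t - r| with hu
  set X : Set (Fin d → ℝ) := {x | p x ≤ r + u} with hX
  have htX : p t ≤ r + u := by linarith [le_abs_self (p t - r)]
  have hXg : ∀ l ∈ L, ∀ x ∈ X, dualMap R l x ∈ X := by
    intro l hl x hx
    have h1 := hp _ (Finset.mem_image_of_mem _ hl) x u hx
    rw [← sub_eq_add_neg] at h1
    have h2 : θ * u ≤ u := mul_le_of_le_one_left (abs_nonneg _) hθ1.le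
    exact h1.trans (by linarith)
  have hXc : IsCompact X := by
    refine (isCompact_closedBall (0 : Fin d → ℝ) (r + u)).of_isClosed_subset
      (isClosed_le hpc continuous_const) fun x hx => ?_
    rw [mem_closedBall_zero_iff]
    exact (hpn x).trans hx
  obtain ⟨t₀, ht₀, hmin⟩ := hXc.exists_isMinOn ⟨t, htX⟩ hcont.continuousOn
  set c := frameFun R L α μ t₀ with hc
  have hstep : ∀ l ∈ L, ∀ s ∈ X, frameFun R L α μ s = c →
      ‖α l‖ * ‖maskB B (dualMap R l s)‖ ≠ 0 → frameFun R L α μ (dualMap R l s) = c := by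
    intro l hl s hs hsc hne
    -- The functional equation minus `c` times the sum of its coefficients; each term is nonnegative
    -- on `X`, so each vanishes.
    have h1 : ∑ l ∈ L, ‖α l‖ ^ 2 * ‖maskB B (dualMap R l s)‖ ^ 2 *
        (frameFun R L α μ (dualMap R l s) - c) = 0 := by
      simp only [mul_sub]
      rw [Finset.sum_sub_distrib, frameFun_ruelle hR hL h0 hiso hμ, ← Finset.sum_mul,
        sum_weights_eq_one hiso hμ, hsc]
      ring
    have h2 := (Finset.sum_eq_zero_iff_of_nonneg fun l hl =>
      mul_nonneg (by positivity) (sub_nonneg.2 (hmin (hXg l hl s hs)))).1 h1 l hl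
    rw [← mul_pow] at h2
    exact sub_eq_zero.1 ((mul_eq_zero.1 h2).resolve_left (pow_ne_zero 2 hne))
  -- A nonzero coefficient of `l :: w` at `s` forces a nonzero coefficient of the letter `l` in the
  -- equation and a nonzero coefficient of `w` at `g_l(s)`, so the minimum follows the word until it
  -- is used up.
  have hword : ∀ w : List (Fin d → ℤ), (∀ l ∈ w, l ∈ L) → ∀ s ∈ X, frameFun R L α μ s = c →
      wordCoeff R α μ (expBdd s) w ≠ 0 →
      ∃ s' ∈ X, frameFun R L α μ s' = c ∧ wordCoeff R α μ (expBdd s') [] ≠ 0 := by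
    intro w
    induction w with
    | nil => exact fun _ s hs hsc hne => ⟨s, hs, hsc, hne⟩
    | cons l w ih =>
      intro hw s hs hsc hne
      have hl := hw l (by simp)
      rw [← norm_ne_zero_iff, norm_wordCoeff_expBdd_cons hR hμ, mul_ne_zero_iff] at hne
      exact ih (fun a ha => hw a (by simp [ha])) _ (hXg l hl s hs) (hstep l hl s hs hsc hne.1)
        (norm_ne_zero_iff.1 hne.2)
  obtain ⟨w, hw⟩ : ∃ w : Words L, wordCoeff R α μ (expBdd t₀) w.letters ≠ 0 := by
    by_contra! h
    have h1 := hpos t₀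
    simp [frameFun, h] at h1
  obtain ⟨s, hsX, hsc, hs⟩ := hword w.letters (fun l hl => w.mem_of_mem_letters hl) t₀ ht₀ rfl hw
  have hiter : ∀ n : ℕ, ((realMat R)ᵀ⁻¹ ^ n) *ᵥ s ∈ X ∧
      frameFun R L α μ (((realMat R)ᵀ⁻¹ ^ n) *ᵥ s) = c ∧
      wordCoeff R α μ (expBdd (((realMat R)ᵀ⁻¹ ^ n) *ᵥ s)) [] ≠ 0 := by
    intro n
    induction n with
    | zero => simpa using ⟨hsX, hsc, hs⟩
    | succ n ih =>
      obtain ⟨h1, h2, h3⟩ := ih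
      have h4 : ((realMat R)ᵀ⁻¹ ^ (n + 1)) *ᵥ s = dualMap R 0 (((realMat R)ᵀ⁻¹ ^ n) *ᵥ s) := by
        rw [dualMap_zero, Matrix.mulVec_mulVec, pow_succ']
      -- Reading the empty word as the letter `0` allows one more application of `g_0`, again
      -- leaving the empty word.
      have h5 : wordCoeff R α μ (expBdd (((realMat R)ᵀ⁻¹ ^ n) *ᵥ s)) [] =
          wordCoeff R α μ (expBdd (((realMat R)ᵀ⁻¹ ^ n) *ᵥ s)) [0] := by
        simp [wordCoeff, wordFreq_nil, wordFreq_cons, wordWeight, h0]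
      rw [h5, ← norm_ne_zero_iff, norm_wordCoeff_expBdd_cons hR hμ, mul_ne_zero_iff, ← h4] at h3
      refine ⟨h4 ▸ hXg 0 hL _ h1, ?_, norm_ne_zero_iff.1 h3.2⟩
      rw [h4]
      exact hstep 0 hL _ h1 h2 (h4 ▸ h3.1)
  have hlim : Tendsto (fun n : ℕ => ((realMat R)ᵀ⁻¹ ^ n) *ᵥ s) atTop (𝓝 0) := by
    have h1 : Continuous fun M : Matrix (Fin d) (Fin d) ℝ => M *ᵥ s :=
      Continuous.matrix_mulVec continuous_id continuous_const
    have h2 := (h1.tendsto 0).comp (tendsto_inv_realMat_transpose_pow hR)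
    rwa [Matrix.zero_mulVec] at h2
  have hlim2 := (hcont.tendsto 0).comp hlim
  have hc1 : c = 1 := by
    rw [← frameFun_zero hR hL h0 hiso hμ]
    refine tendsto_nhds_unique ?_ hlim2
    exact tendsto_const_nhds.congr fun n => (hiter n).2.1.symm
  refine le_antisymm (frameFun_le_one he t) ?_
  rw [← hc1]
  exact hmin htX

theorem isParsevalFrame_of_frameFun_eq_one (hR : IsExpansive R) (hB : B.Nonempty)
    (he : IsBesselFamily (weightedExp R L α μ)) (hμ : IsSelfAffineMeasure R B μ)
    (h : ∀ t, frameFun R L α μ t = 1) : IsParsevalFrame (weightedExp R L α μ) := by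
  obtain ⟨r, hr⟩ := hμ.exists_ae_norm_le hR hB
  refine he.isParsevalFrame (topologicalClosure_span_toL2_expBdd hr) ?_
  rintro - ⟨t, rfl⟩
  have h1 := he.hasSum_norm_sq (toL2 μ (expBdd t))
  rwa [← frameFun_eq_norm_sq he, h, ← norm_toL2_expBdd (μ := μ) t] at h1

end FrameFun

end FractalFrame

end

/-! ### Conclusion: from `L` to `L'`. -/

open FractalFrame
theorem corollary3p2 {d : ℕ} (R : Matrix (Fin d) (Fin d) ℤ) (hR : IsExpansive R)
    (B : Finset (Fin d → ℤ)) (hB : (0 : Fin d → ℤ) ∈ B)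
    (μ : MeasureTheory.Measure (Fin d → ℝ)) [MeasureTheory.IsProbabilityMeasure μ]
    (hμ : IsSelfAffineMeasure R B μ) (hno : NoOverlap R B μ)
    (L : Finset (Fin d → ℤ)) (hL : (0 : Fin d → ℤ) ∈ L) (α : (Fin d → ℤ) → ℂ)
    (hi : α 0 = 1) (hii : IsometryCondition R B L α) (hiii : UniquenessCondition R B L α)
    (L' : Finset (Fin d → ℤ)) (hLL' : L ⊆ L') (α' : (Fin d → ℤ) → ℂ)
    (hne : ∀ l ∈ L', α' l ≠ 0)
    (hi' : α' 0 = 1) (hii' : IsometryCondition R B L' α') :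
    IsParsevalFrame (weightedExp R L' α' μ) := by
  have hBne : B.Nonempty := ⟨0, hB⟩
  have hL' := hLL' hL
  refine isParsevalFrame_of_frameFun_eq_one hR hBne
    (isBesselFamily_weightedExp hR hL' hi' hii' hμ) hμ ?_
  refine frameFun_eq_one_of_pos hR hBne hL' hi' hii' hμ fun t => ?_
  refine frameFun_pos_of_subset hLL' hne (α := α)
    (summable_norm_sq_wordCoeff hR hL' hi' hii' hμ (expBdd t)) ?_
  rw [frameFun_eq_one_of_uniqueness hR hBne hL hi hii hiii hμ]
  exact one_pos
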